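/- Fix an integer $d\ge 2$. For a $d$-uniform hypergraph $H$ on $[n]$, the projection $\mathrm{Proj}(H)$ is the graph on $[n]$ in which two distinct vertices are adjacent iff some hyperedge of $H$ contains both. A preimage of a graph $G$ is a $d$-uniform hypergraph $H$ on the same vertex set with $\mathrm{Proj}(H)=G$; a minimum preimage is a preimage with the fewest hyperedges. The clique hypergraph $\mathrm{Cli}(G)$ consists of the vertex sets of all $d$-cliques of $G$. A 2-connected component of a hypergraph is the set of hyperedges in a connected component of the graph on its hyperedges in which two hyperedges are adjacent iff they share at least two vertices. For real $\delta$, let $\mathcal H=\mathcal H_{n,\delta}$ be the random $d$-uniform hypergraph on $[n]$ containing each $d$-subset independently with probability $p=n^{-d+1+\delta}$, and let $G_p=\mathrm{Proj}(\mathcal H)$. **Theorem.** There are a rule $\mathcal A^*$, assigning to each graph on $[n]$ (for each $n$) a hypergraph on $[n]$, and a single program $M$ (independent of $n$ and $\delta$) such that: 1. for every $n$ and every graph $G$ on $[n]$ that has a preimage, $\mathcal A^*(G)$ is a minimum preimage of $G$; more precisely, $\mathcal A^*(G)=\bigcup_C B(C)$, the union over the 2-connected components $C$ of $\mathrm{Cli}(G)$,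 where $B$ assigns to every $d$-uniform hypergraph $C$ on $[n]$ a minimum preimage $B(C)$ of $\mathrm{Proj}(C)$; 2. for every $n$ and every graph $G$ on $[n]$ that has a preimage, $M$ halts on input $G$ with output $\mathcal A^*(G)$; 3. for every real $\delta<\frac{d-1}{d+1}$, $\mathcal A^*$ is a maximum a posteriori (MAP) rule: for every $n$, every $G$ on $[n]$ that has a preimage and every hypergraph $H$ on $[n]$, $\Pr(\mathcal H=H\mid G_p=G)\le\Pr(\mathcal H=\mathcal A^*(G)\mid G_p=G)$ (a conditional probability given an event of probability $0$ being read as $0$); 4. for every real $\delta<\frac{d-1}{d+1}$ there is a polynomial $q$ such that, with probability tending to $1$ as $n\to\infty$, $M$ on input $G_p$ halts with output $\mathcal A^*(G_p)$ within time $q(n)$. Here a program is a deterministic while-program on finite binary trees, built from the operations identity, nil, pairing and the two projections by composition, branching and while loops (testing for nil), where each execution of a program construct is charged the size of the tree it is applied to (so polynomial time agrees with polynomial time on Turing machines). A graph is input as its adjacency matrix, and a hypergraph is output as a list of its hyperedges, each hyperedge being the increasing list of its vertices in unary. -/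

import Mathlib

open Filter Topology

/-! ### Hypergraphs on `[n]`, graph projection, minimum preimages -/

namespace HypRec

/-- A hypergraph with vertex set `[n]`, given by its set of hyperedges. -/
abbrev Hyp (n : ℕ) := Finset (Finset (Fin n))

/-- `H` is `d`-uniform: all hyperedges have exactly `d` vertices. -/
def Uniform (d : ℕ) {n : ℕ} (H : Hyp n) : Prop := ∀ h ∈ H, h.card = d

/-- The projected graph of `H`: two distinct vertices are adjacent iff some hyperedge contains
both of them. -/
def proj {n : ℕ} (H : Hyp n) : SimpleGraph (Fin n) where
  Adj i j := i ≠ j ∧ ∃ h ∈ H, i ∈ h ∧ j ∈ h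
  symm := ⟨fun _ _ hij => ⟨hij.1.symm, hij.2.imp fun _ hh => ⟨hh.1, hh.2.2, hh.2.1⟩⟩⟩
  loopless := ⟨fun _ hi => hi.1 rfl⟩

/-- `H` is a preimage of `G`: a `d`-uniform hypergraph whose projection is `G`. -/
def IsPreimage (d : ℕ) {n : ℕ} (G : SimpleGraph (Fin n)) (H : Hyp n) : Prop :=
  Uniform d H ∧ proj H = G

/-- `H` is a minimum preimage of `G`: a preimage with the smallest number of hyperedges. -/
def IsMinPreimage (d : ℕ) {n : ℕ} (G : SimpleGraph (Fin n)) (H : Hyp n) : Prop :=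
  IsPreimage d G H ∧ ∀ H' : Hyp n, IsPreimage d G H' → H.card ≤ H'.card

/-- The clique hypergraph of `G`: its hyperedges are the vertex sets of the `d`-cliques of `G`. -/
noncomputable def cliqueHyp (d : ℕ) {n : ℕ} (G : SimpleGraph (Fin n)) : Hyp n :=
  open scoped Classical in G.cliqueFinset d

/-! ### 2-connected components -/

/-- The graph on the hyperedges of `H` in which two hyperedges are adjacent iff they share at
least two vertices. -/
def twoNeighborGraph {n : ℕ} (H : Hyp n) : SimpleGraph {h : Finset (Fin n) // h ∈ H} where
  Adj h h' := h ≠ h' ∧ 2 ≤ (h.1 ∩ h'.1).card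
  symm := ⟨fun h h' hh => ⟨hh.1.symm, by rw [Finset.inter_comm]; exact hh.2⟩⟩
  loopless := ⟨fun _ hh => hh.1 rfl⟩

/-- `C` is a 2-connected component of `H`: the set of hyperedges in one connected component of the
2-neighbor graph. -/
def IsTwoComponent {n : ℕ} (H C : Hyp n) : Prop :=
  ∃ c : (twoNeighborGraph H).ConnectedComponent,
    ∀ h : Finset (Fin n), h ∈ C ↔
      ∃ hh : h ∈ H, (twoNeighborGraph H).connectedComponentMk ⟨h, hh⟩ = c

/-! ### The random hypergraph -/

/-- The probability that the random `d`-uniform hypergraph on `[n]`, which contains each of the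
`d`-subsets of `[n]` independently with probability `p`, satisfies `E`. -/
noncomputable def prob (d n : ℕ) (p : ℝ) (E : Hyp n → Prop) : ℝ :=
  open scoped Classical in
  ∑ H ∈ (Finset.powersetCard d (Finset.univ : Finset (Fin n))).powerset with E H,
    p ^ H.card * (1 - p) ^ (n.choose d - H.card)

/-- The posterior probability of `H` given that the projected graph is `G`. -/
noncomputable def posterior (d n : ℕ) (p : ℝ) (G : SimpleGraph (Fin n)) (H : Hyp n) : ℝ :=
  prob d n p (fun K => K = H ∧ proj K = G) / prob d n p (fun K => proj K = G)

/-- The hyperedge probability `p = n ^ (-d + 1 + δ)`. -/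
noncomputable def edgeProb (d n : ℕ) (δ : ℝ) : ℝ := (n : ℝ) ^ (-(d : ℝ) + 1 + δ)

/-! ### Machine model: while programs on binary trees

Data are finite binary trees; the elementary operations are `nil`, pairing, the two projections
and the test for `nil`; control is composition, branching and unbounded `while` loops. Every
operation is charged the full size of the tree it is applied to (the time for reading or copying
it), so that polynomial time is the same as for Turing machines. -/

/-- Finite binary trees. -/
inductive Data : Type
  | nil : Data
  | cons : Data → Data → Data

namespace Data

/-- The number of nodes (leaves included). -/
def size : Data → ℕ
  | nil => 1
  | cons a b => a.size + b.size + 1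

/-- Left subtree. -/
def fst : Data → Data
  | nil => nil
  | cons a _ => a

/-- Right subtree. -/
def snd : Data → Data
  | nil => nil
  | cons _ b => b

/-- Truth values: `nil` is false. -/
noncomputable def ofProp (P : Prop) : Data :=
  open scoped Classical in if P then cons nil nil else nil

/-- Natural numbers in unary. -/
def ofNat : ℕ → Data
  | 0 => nil
  | k + 1 => cons nil (ofNat k)

/-- Finite lists. -/
def ofList : List Data → Data
  | [] => nil
  | a :: l => cons a (ofList l)

end Data

/-- Programs; each computes a partial function from trees to trees. -/
inductive Prog : Type
  | id : Prog
  | nil : Prog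
  | fst : Prog
  | snd : Prog
  | pair : Prog → Prog → Prog
  | comp : Prog → Prog → Prog
  | branch : Prog → Prog → Prog → Prog
  | loop : Prog → Prog → Prog

/-- `Eval M x y t`: program `M` on input `x` halts with output `y` after time `t`.
`comp g f` runs `f` and then `g`; `branch c f g` is "if `c` then `f` else `g`";
`loop c f` is "while `c` do `f`". -/
inductive Eval : Prog → Data → Data → ℕ → Prop
  | id (x : Data) : Eval .id x x x.size
  | nil (x : Data) : Eval .nil x .nil x.size
  | fst (x : Data) : Eval .fst x x.fst x.size
  | snd (x : Data) : Eval .snd x x.snd x.size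
  | pair {f g : Prog} {x y z : Data} {s t : ℕ} :
      Eval f x y s → Eval g x z t → Eval (.pair f g) x (.cons y z) (x.size + s + t)
  | comp {f g : Prog} {x y z : Data} {s t : ℕ} :
      Eval f x y s → Eval g y z t → Eval (.comp g f) x z (x.size + s + t)
  | branch_true {c f g : Prog} {x b y : Data} {s t : ℕ} :
      Eval c x b s → b ≠ .nil → Eval f x y t → Eval (.branch c f g) x y (x.size + s + t)
  | branch_false {c f g : Prog} {x y : Data} {s t : ℕ} :
      Eval c x .nil s → Eval g x y t → Eval (.branch c f g) x y (x.size + s + t)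
  | loop_stop {c f : Prog} {x : Data} {s : ℕ} :
      Eval c x .nil s → Eval (.loop c f) x x (x.size + s)
  | loop_step {c f : Prog} {x b y z : Data} {s t u : ℕ} :
      Eval c x b s → b ≠ .nil → Eval f x y t → Eval (.loop c f) y z u →
      Eval (.loop c f) x z (x.size + s + t + u)

/-- Input encoding of a graph: its adjacency matrix, as the list of its rows. -/
noncomputable def encodeGraph {n : ℕ} (G : SimpleGraph (Fin n)) : Data :=
  .ofList (List.ofFn fun i : Fin n =>
    .ofList (List.ofFn fun j : Fin n => .ofProp (G.Adj i j)))

/-- Encoding of a hyperedge: the increasing list of its vertices. -/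
def encodeEdge {n : ℕ} (h : Finset (Fin n)) : Data :=
  .ofList ((h.sort (· ≤ ·)).map fun v => .ofNat v.val)

/-- `y` is an output encoding of `H`: a list, in some order, of the hyperedges of `H`, each of them
occurring once. -/
def EncodesHyp {n : ℕ} (y : Data) (H : Hyp n) : Prop :=
  ∃ L : List (Finset (Fin n)), L.Nodup ∧ (∀ h, h ∈ L ↔ h ∈ H) ∧ y = .ofList (L.map encodeEdge)

/-- Program `M`, given the graph `G`, halts within time `T` and outputs the hypergraph `H`. -/
def OutputsWithin {n : ℕ} (M : Prog) (G : SimpleGraph (Fin n)) (H : Hyp n) (T : ℕ) : Prop :=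
  ∃ (y : Data) (t : ℕ), Eval M (encodeGraph G) y t ∧ EncodesHyp y H ∧ t ≤ T

end HypRec

/-! Decomposition. Every preimage of `G` lies inside `Cli(G)`, so finding a minimum preimage means
covering the edges of `G` by as few `d`-cliques as possible. Two cliques that contain a common edge
share two vertices, hence lie in one 2-connected component. Each edge is therefore covered within a
single component, and both the covering condition and the number of hyperedges split over the
components (`isMinPreimage_astar`). Brute force on each component gives `astar`.

MAP. The posterior weight of a preimage `H` is proportional to `p ^ |H| (1 - p) ^ (N - |H|)` with `N
= n.choose d`, which favours small `H` as soon as `p ≤ 1/2`. This bound holds when `3 ≤ d ≤ n`. In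
the remaining cases, `d = 2` or `n < d`, the preimage is unique.

Running time. The search costs `2 ^ |C|` on a component `C`, so it suffices that components have
bounded size with high probability. Explore a component while keeping a set `S` of hyperedges of
`H`. As long as the component is not inside the vertex set `V` of `S`, some clique `h` in it meets
`V` in at least two vertices without lying in `V`. Adding hyperedges of `H` that cover the new pairs
of `h` brings at most `d - 1 - (d-1)/(d+1)` new vertices per added hyperedge (`exists_extension`).
The expected number of copies of `S` in the random hypergraph has order at most `n ^ (|V| - |S| (d -
1 - δ))`, and each round lowers this exponent by at least `(d-1)/(d+1) - δ > 0`. After boundedly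
many rounds it would be negative, which the first moment method excludes with high probability
(`tendsto_sum_denseHyps`). Hence the exploration stops early and the component lives on boundedly
many vertices (`card_component_le`).

The program is assembled from closure properties of `CompIn`, whose weight argument isolates the one
exponential ingredient, the enumeration of sublists. -/

namespace HypRec

/-! ### Encodings and size -/

/-- Types whose elements are represented by trees. -/
class Enc (α : Type) where
  /-- the representation -/
  enc : α → Data

open Enc

instance : Enc Unit := ⟨fun _ => .nil⟩
instance : Enc Bool := ⟨fun b => if b then .cons .nil .nil else .nil⟩
instance : Enc ℕ := ⟨Data.ofNat⟩
instance {α : Type} [Enc α] : Enc (List α) := ⟨fun l => .ofList (l.map enc)⟩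
instance {α β : Type} [Enc α] [Enc β] : Enc (α × β) := ⟨fun p => .cons (enc p.1) (enc p.2)⟩

/-- Size of the representation. -/
def esize {α : Type} [Enc α] (a : α) : ℕ := (enc a).size

variable {α β γ σ : Type} [Enc α] [Enc β] [Enc γ] [Enc σ]

theorem Data.size_pos (x : Data) : 1 ≤ x.size := by
  cases x <;> simp [Data.size]

theorem esize_pair (a : α) (b : β) : esize (a, b) = esize a + esize b + 1 := rfl

theorem esize_nil : esize ([] : List α) = 1 := rfl

theorem esize_cons (a : α) (l : List α) : esize (a :: l) = esize a + esize l + 1 := rfl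

theorem esize_nat (k : ℕ) : esize k = 2 * k + 1 := by
  induction k with
  | zero => rfl
  | succ k ih =>
    change (Data.cons .nil (Data.ofNat k)).size = _
    have : (Data.ofNat k).size = 2 * k + 1 := ih
    simp only [Data.size, this]; ring

theorem esize_bool (b : Bool) : esize b ≤ 3 := by
  cases b <;> simp [esize, enc, Data.size]

theorem esize_append (l₁ l₂ : List α) : esize (l₁ ++ l₂) + 1 = esize l₁ + esize l₂ := by
  induction l₁ with
  | nil => simp [esize_nil, add_comm]
  | cons a l ih => simp only [List.cons_append, esize_cons]; omega

theorem esize_reverse (l : List α) : esize l.reverse = esize l := by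
  induction l with
  | nil => rfl
  | cons a l ih =>
    have := esize_append l.reverse [a]
    simp only [List.reverse_cons, esize_cons, esize_nil] at *; omega

theorem esize_sublist {l₁ l₂ : List α} (h : l₁.Sublist l₂) : esize l₁ ≤ esize l₂ := by
  induction h with
  | slnil => exact le_rfl
  | cons a _ ih => rw [esize_cons]; omega
  | cons_cons a _ ih => simp only [esize_cons]; omega

theorem esize_le_of_mem {a : α} {l : List α} (h : a ∈ l) : esize a ≤ esize l := by
  have := esize_sublist (List.singleton_sublist.2 h)
  rw [esize_cons] at this; omega

theorem length_le_esize (l : List α) : l.length ≤ esize l := by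
  induction l with
  | nil => simp
  | cons a l ih => rw [esize_cons, List.length_cons]; omega

theorem esize_list_le {l : List α} {z : ℕ} (h : ∀ a ∈ l, esize a ≤ z) :
    esize l ≤ l.length * (z + 1) + 1 := by
  induction l with
  | nil => simp [esize_nil]
  | cons a l ih =>
    have h1 := ih fun b hb => h b (List.mem_cons_of_mem _ hb)
    have h2 := h a List.mem_cons_self
    rw [esize_cons, List.length_cons, add_mul]; omega

theorem eval_le_eval (q : Polynomial ℕ) {x y : ℕ} (h : x ≤ y) : q.eval x ≤ q.eval y := by
  rw [Polynomial.eval_eq_sum, Polynomial.eval_eq_sum]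
  exact Finset.sum_le_sum fun i _ => Nat.mul_le_mul_left _ (Nat.pow_le_pow_left h _)

/-- Each construct is charged the size of its input, so building a large output takes time. Every
time bound thereby doubles as a size bound, which is what makes `CompIn` closed under composition.
-/
theorem Eval.size_le {M : Prog} {x y : Data} {t : ℕ} (h : Eval M x y t) : y.size ≤ t := by
  induction h with
  | id x => exact le_rfl
  | nil x => exact Data.size_pos x
  | fst x => cases x <;> simp only [Data.fst, Data.size] <;> omega
  | snd x => cases x <;> simp only [Data.snd, Data.size] <;> omega
  | @pair f g x y z s t _ _ h1 h2 =>
    have := Data.size_pos x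
    simp only [Data.size]; omega
  | comp _ _ _ h => omega
  | branch_true _ _ _ _ h => omega
  | branch_false _ _ _ h => omega
  | loop_stop => omega
  | loop_step _ _ _ _ _ _ h => omega

/-! ### Computability within polynomial bounds -/

/-- `f` is computed by a program in time polynomial in the size of the input and its weight. -/
def CompIn (w : α → ℕ) (f : α → β) : Prop :=
  ∃ (M : Prog) (q : Polynomial ℕ), ∀ a, ∃ t, Eval M (enc a) (enc (f a)) t ∧
    t ≤ q.eval (esize a + w a)

/-- `f` is computed by a program in polynomial time. -/
def PolyTime (f : α → β) : Prop := CompIn (fun _ => 0) f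

theorem CompIn.size_le {w : α → ℕ} {f : α → β} (h : CompIn w f) :
    ∃ q : Polynomial ℕ, ∀ a, esize (f a) ≤ q.eval (esize a + w a) := by
  obtain ⟨M, q, h⟩ := h
  refine ⟨q, fun a => ?_⟩
  obtain ⟨t, h1, h2⟩ := h a
  exact h1.size_le.trans h2

theorem CompIn.mono {w w' : α → ℕ} {f : α → β} (h : CompIn w f) (hw : ∀ a, w a ≤ w' a) :
    CompIn w' f := by
  obtain ⟨M, q, h⟩ := h
  refine ⟨M, q, fun a => ?_⟩
  obtain ⟨t, h1, h2⟩ := h a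
  exact ⟨t, h1, h2.trans (eval_le_eval q (by have := hw a; omega))⟩

theorem PolyTime.compIn {f : α → β} (h : PolyTime f) (w : α → ℕ) : CompIn w f :=
  CompIn.mono h fun _ => Nat.zero_le _

theorem CompIn.comp {w : α → ℕ} {w' : β → ℕ} {f : α → β} {g : β → γ} (hg : CompIn w' g)
    (hf : CompIn w f) (r : Polynomial ℕ) (hr : ∀ a, w' (f a) ≤ r.eval (esize a + w a)) :
    CompIn w (fun a => g (f a)) := by
  obtain ⟨M, q, hf⟩ := hf
  obtain ⟨M', q', hg⟩ := hg
  refine ⟨.comp M' M, .X + q + q'.comp (q + r), fun a => ?_⟩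
  obtain ⟨t, h1, h2⟩ := hf a
  obtain ⟨t', h3, h4⟩ := hg (f a)
  refine ⟨_, .comp h1 h3, ?_⟩
  simp only [Polynomial.eval_add, Polynomial.eval_X, Polynomial.eval_comp]
  have h5 : esize (f a) ≤ t := h1.size_le
  have h6 := h4.trans (eval_le_eval q' (add_le_add (h5.trans h2) (hr a)))
  change esize a + t + t' ≤ _
  omega

theorem PolyTime.comp {f : α → β} {g : β → γ} (hg : PolyTime g) (hf : PolyTime f) :
    PolyTime (fun a => g (f a)) :=
  CompIn.comp hg hf 0 (by simp)

theorem PolyTime.comp_compIn {w : α → ℕ} {f : α → β} {g : β → γ} (hg : PolyTime g)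
    (hf : CompIn w f) : CompIn w (fun a => g (f a)) :=
  CompIn.comp hg hf 0 (by simp)

theorem CompIn.comp_polyTime {w : β → ℕ} {f : α → β} {g : β → γ} (hg : CompIn w g)
    (hf : PolyTime f) : CompIn (fun a => w (f a)) (fun a => g (f a)) :=
  CompIn.comp hg (hf.compIn _) .X (by simp)

theorem CompIn.pair {w : α → ℕ} {f : α → β} {g : α → γ} (hf : CompIn w f)
    (hg : CompIn w g) : CompIn w (fun a => (f a, g a)) := by
  obtain ⟨M, q, hf⟩ := hf
  obtain ⟨M', q', hg⟩ := hg
  refine ⟨.pair M M', .X + q + q', fun a => ?_⟩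
  obtain ⟨t, h1, h2⟩ := hf a
  obtain ⟨t', h3, h4⟩ := hg a
  refine ⟨_, .pair h1 h3, ?_⟩
  simp only [Polynomial.eval_add, Polynomial.eval_X]
  change esize a + t + t' ≤ _
  omega

theorem PolyTime.pair {f : α → β} {g : α → γ} (hf : PolyTime f) (hg : PolyTime g) :
    PolyTime (fun a => (f a, g a)) := CompIn.pair hf hg

theorem PolyTime.of_eval {f : α → β} (M : Prog) (k : ℕ)
    (h : ∀ a, ∃ t, Eval M (enc a) (enc (f a)) t ∧ t ≤ k * esize a) : PolyTime f :=
  ⟨M, .C k * .X, fun a => by simpa using h a⟩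

theorem PolyTime.id : PolyTime (fun a : α => a) :=
  .of_eval .id 1 fun _ => ⟨_, .id _, (one_mul _).ge⟩

theorem PolyTime.fst : PolyTime (fun p : α × β => p.1) :=
  .of_eval .fst 1 fun _ => ⟨_, .fst _, (one_mul _).ge⟩

theorem PolyTime.snd : PolyTime (fun p : α × β => p.2) :=
  .of_eval .snd 1 fun _ => ⟨_, .snd _, (one_mul _).ge⟩

theorem exists_const_prog (y : Data) : ∃ (M : Prog) (k : ℕ), ∀ x, ∃ t, Eval M x y t ∧
    t ≤ k * x.size := by
  induction y with
  | nil => exact ⟨.nil, 1, fun x => ⟨_, .nil x, by simp⟩⟩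
  | cons a b iha ihb =>
    obtain ⟨M, k, h⟩ := iha
    obtain ⟨M', k', h'⟩ := ihb
    refine ⟨.pair M M', 1 + k + k', fun x => ?_⟩
    obtain ⟨t, h1, h2⟩ := h x
    obtain ⟨t', h3, h4⟩ := h' x
    exact ⟨_, .pair h1 h3, by rw [add_mul, add_mul]; omega⟩

theorem PolyTime.const (b : β) : PolyTime (fun _ : α => b) := by
  obtain ⟨M, k, h⟩ := exists_const_prog (enc b)
  exact .of_eval M k fun a => h _

/-- Functions with the same representation are computed by the same programs. -/
theorem CompIn.of_enc_eq {w : α → ℕ} {f : α → β} {g : α → γ} (hf : CompIn w f)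
    (h : ∀ a, enc (f a) = enc (g a)) : CompIn w g := by
  obtain ⟨M, q, hf⟩ := hf
  exact ⟨M, q, fun a => h a ▸ hf a⟩

theorem CompIn.ite {w : α → ℕ} {c : α → Bool} {f g : α → β} (hc : CompIn w c)
    (hf : CompIn w f) (hg : CompIn w g) : CompIn w (fun a => if c a then f a else g a) := by
  obtain ⟨M, q, hf⟩ := hf
  obtain ⟨M', q', hg⟩ := hg
  obtain ⟨N, r, hc⟩ := hc
  refine ⟨.branch N M M', .X + r + q + q', fun a => ?_⟩
  obtain ⟨t, h1, h2⟩ := hf a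
  obtain ⟨t', h3, h4⟩ := hg a
  obtain ⟨s, h5, h6⟩ := hc a
  simp only [Polynomial.eval_add, Polynomial.eval_X]
  cases hca : c a with
  | true =>
    rw [hca] at h5
    refine ⟨_, .branch_true h5 (by simp [enc]) (by simpa using h1), ?_⟩
    change esize a + s + t ≤ _
    omega
  | false =>
    rw [hca] at h5
    refine ⟨_, .branch_false h5 (by simpa using h3), ?_⟩
    change esize a + s + t' ≤ _
    omega

theorem PolyTime.ite {c : α → Bool} {f g : α → β} (hc : PolyTime c)
    (hf : PolyTime f) (hg : PolyTime g) : PolyTime (fun a => if c a then f a else g a) :=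
  CompIn.ite hc hf hg

theorem PolyTime.and {f g : α → Bool} (hf : PolyTime f) (hg : PolyTime g) :
    PolyTime (fun a => f a && g a) := by
  have := hf.ite hg (.const false)
  refine this.of_enc_eq fun a => ?_
  cases f a <;> simp

theorem PolyTime.or {f g : α → Bool} (hf : PolyTime f) (hg : PolyTime g) :
    PolyTime (fun a => f a || g a) := by
  have := hf.ite (.const true) hg
  refine this.of_enc_eq fun a => ?_
  cases f a <;> simp

theorem PolyTime.not {f : α → Bool} (hf : PolyTime f) : PolyTime (fun a => !f a) := by
  have := hf.ite (.const false) (.const true)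
  refine this.of_enc_eq fun a => ?_
  cases f a <;> simp

theorem PolyTime.cons {f : α → β} {g : α → List β} (hf : PolyTime f) (hg : PolyTime g) :
    PolyTime (fun a => f a :: g a) :=
  CompIn.of_enc_eq (hf.pair hg) fun _ => rfl

theorem PolyTime.tail {f : α → List β} (hf : PolyTime f) : PolyTime (fun a => (f a).tail) := by
  refine PolyTime.comp (g := fun l : List β => l.tail) ?_ hf
  refine .of_eval .snd 1 fun l => ?_
  cases l <;> exact ⟨_, .snd _, (one_mul _).ge⟩

/-- The left projection of `nil` is `nil`, so it returns the default on the empty list exactly when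
the default is encoded by `nil`. -/
theorem PolyTime.headD {f : α → List β} (hf : PolyTime f) (b : β) (hb : enc b = .nil) :
    PolyTime (fun a => (f a).headD b) := by
  refine PolyTime.comp (g := fun l : List β => l.headD b) ?_ hf
  refine .of_eval .fst 1 fun l => ?_
  cases l with
  | nil =>
    refine ⟨_, ?_, (one_mul _).ge⟩
    rw [List.headD_nil, hb]; exact .fst _
  | cons a l => exact ⟨_, .fst _, (one_mul _).ge⟩

theorem PolyTime.isEmpty {f : α → List β} (hf : PolyTime f) :
    PolyTime (fun a => (f a).isEmpty) := by
  refine PolyTime.comp (g := fun l : List β => l.isEmpty) ?_ hf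
  obtain ⟨M, k, h⟩ := exists_const_prog (enc true)
  refine .of_eval (.branch .id .nil M) (2 + k + 1) fun l => ?_
  cases l with
  | nil =>
    obtain ⟨t, h1, h2⟩ := h .nil
    refine ⟨_, .branch_false (.id _) h1, ?_⟩
    change 1 + 1 + t ≤ _ * 1
    simp only [Data.size] at h2; omega
  | cons a l =>
    refine ⟨_, .branch_true (.id _) (by simp [enc, Data.ofList]) (.nil _), ?_⟩
    change esize (a :: l) + esize (a :: l) + esize (a :: l) ≤ _
    nlinarith

/-! ### Folds -/

/-- The loop of a fold over a list, on inputs `(list, context, state)`. -/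
def foldProg (M : Prog) : Prog :=
  .loop .fst (.pair (.comp .snd .fst) (.pair (.comp .fst .snd)
    (.comp M (.pair (.comp .fst .snd) (.pair (.comp .fst .fst) (.comp .snd .snd))))))

/-- The bounds are required only at states reached from a prefix of `l`, a form that survives the
induction. The factor 30 generously absorbs the size charges of one pass through the loop. -/
theorem eval_foldProg {M : Prog} {g : α × β × σ → σ} {a : α} {Z T : ℕ} (l : List β) (s : σ)
    (hZ : ∀ l₁ l₂, l = l₁ ++ l₂ →
      esize (l₂, a, l₁.foldl (fun s b => g (a, b, s)) s) ≤ Z)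
    (hT : ∀ l₁ b l₂, l = l₁ ++ b :: l₂ → ∃ t,
      Eval M (enc (a, b, l₁.foldl (fun s b => g (a, b, s)) s))
        (enc (g (a, b, l₁.foldl (fun s b => g (a, b, s)) s))) t ∧ t ≤ T) :
    ∃ t, Eval (foldProg M) (enc (l, a, s))
      (enc (([] : List β), a, l.foldl (fun s b => g (a, b, s)) s)) t ∧
      t ≤ (l.length + 1) * (30 * Z + T) := by
  induction l generalizing s with
  | nil =>
    refine ⟨_, Eval.loop_stop (.fst _), ?_⟩
    have := hZ [] [] rfl
    change esize (([] : List β), a, s) + esize (([] : List β), a, s) ≤ _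
    simp only [List.foldl_nil, List.length_nil] at *
    omega
  | cons b l ih =>
    obtain ⟨t, h1, h2⟩ := hT [] b l rfl
    obtain ⟨u, h3, h4⟩ := ih (g (a, b, s)) (fun l₁ l₂ h => hZ (b :: l₁) l₂ (by simp [h]))
      (fun l₁ b' l₂ h => hT (b :: l₁) b' l₂ (by simp [h]))
    have h5 := hZ [] (b :: l) rfl
    refine ⟨_, .loop_step (.fst _) (by simp [enc, Data.ofList, Data.fst])
      (.pair (.comp (.fst _) (.snd _)) (.pair (.comp (.snd _) (.fst _))
        (.comp (.pair (.comp (.snd _) (.fst _)) (.pair (.comp (.fst _) (.fst _))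
          (.comp (.snd _) (.snd _)))) h1))) h3, ?_⟩
    have e1 : (enc (b :: l, a, s)).size = esize (b :: l, a, s) := rfl
    have e2 : (enc (b :: l, a, s)).fst.size = esize (b :: l) := rfl
    have e3 : (enc (b :: l, a, s)).snd.size = esize (a, s) := rfl
    have e4 : (Data.cons (enc (b :: l, a, s)).snd.fst (Data.cons (enc (b :: l, a, s)).fst.fst
      (enc (b :: l, a, s)).snd.snd)).size = esize (a, b, s) := rfl
    simp only [e1, e2, e3, esize_pair, esize_cons, List.foldl_nil, List.length_cons] at *
    have := add_mul (l.length + 1) 1 (30 * Z + T)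
    omega

/-- Iterating a polynomial-time step can make the state grow exponentially, so a polynomial bound on
all intermediate states has to be supplied as `hr`; `hw` does the same for the weights. -/
theorem CompIn.foldl {w : α → ℕ} {w' : α × β × σ → ℕ} {l : α → List β} {s : α → σ}
    {g : α × β × σ → σ} (hl : CompIn w l) (hs : CompIn w s) (hg : CompIn w' g)
    (r : Polynomial ℕ)
    (hr : ∀ a l₁ l₂, l a = l₁ ++ l₂ →
      esize (l₁.foldl (fun s b => g (a, b, s)) (s a)) ≤ r.eval (esize a + w a))
    (hw : ∀ a l₁ b l₂, l a = l₁ ++ b :: l₂ →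
      w' (a, b, l₁.foldl (fun s b => g (a, b, s)) (s a)) ≤ r.eval (esize a + w a)) :
    CompIn w (fun a => (l a).foldl (fun s b => g (a, b, s)) (s a)) := by
  obtain ⟨ql, hql⟩ := hl.size_le
  obtain ⟨M, q, hg⟩ := hg
  obtain ⟨N, p, hN⟩ := hl.pair ((PolyTime.id.compIn w).pair hs)
  let Z : Polynomial ℕ := ql + .X + r + 2
  let T : Polynomial ℕ := q.comp (ql + .X + r + r + 2)
  refine ⟨.comp (.comp .snd .snd) (.comp (foldProg M) N),
    .X + .X + p + (ql + 1) * (30 * Z + T) + 3 * Z, fun a => ?_⟩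
  obtain ⟨t, h1, h2⟩ := hN a
  set x := esize a + w a with hx
  have hxa : esize a ≤ x := Nat.le_add_right _ _
  have hZ : ∀ l₁ l₂, l a = l₁ ++ l₂ →
      esize (l₂, a, l₁.foldl (fun s b => g (a, b, s)) (s a)) ≤ Z.eval x := by
    intro l₁ l₂ h
    have h3 : _ ≤ r.eval x := hr a l₁ l₂ h
    have h4 := esize_sublist (List.sublist_append_right l₁ l₂)
    rw [← h] at h4
    have h5 : _ ≤ ql.eval x := hql a
    simp only [Z, esize_pair, Polynomial.eval_add, Polynomial.eval_X, Polynomial.eval_ofNat]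
    omega
  have hT : ∀ l₁ b l₂, l a = l₁ ++ b :: l₂ → ∃ t,
      Eval M (enc (a, b, l₁.foldl (fun s b => g (a, b, s)) (s a)))
        (enc (g (a, b, l₁.foldl (fun s b => g (a, b, s)) (s a)))) t ∧ t ≤ T.eval x := by
    intro l₁ b l₂ h
    obtain ⟨t, h3, h4⟩ := hg (a, b, l₁.foldl (fun s b => g (a, b, s)) (s a))
    refine ⟨t, h3, h4.trans ?_⟩
    simp only [T, Polynomial.eval_comp, Polynomial.eval_add, Polynomial.eval_X,
      Polynomial.eval_ofNat]
    have h5 : _ ≤ r.eval x := hr a l₁ (b :: l₂) h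
    have h6 : _ ≤ r.eval x := hw a l₁ b l₂ h
    have h7 : esize b ≤ esize (l a) := esize_le_of_mem (by simp [h])
    have h8 : _ ≤ ql.eval x := hql a
    rw [esize_pair, esize_pair]
    exact eval_le_eval q (by omega)
  obtain ⟨u, h3, h4⟩ := eval_foldProg (l a) (s a) hZ hT
  refine ⟨_, .comp (.comp h1 h3) (.comp (.snd _) (.snd _)), ?_⟩
  have h5 := hZ (l a) [] (by simp)
  have h6 : (l a).length + 1 ≤ ql.eval x + 1 :=
    Nat.succ_le_succ ((length_le_esize _).trans (hql a))
  have h7 := h4.trans (Nat.mul_le_mul_right _ h6)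
  simp only [Polynomial.eval_add, Polynomial.eval_X, Polynomial.eval_mul, Polynomial.eval_ofNat,
    Polynomial.eval_one]
  generalize (ql.eval x + 1) * (30 * Z.eval x + T.eval x) = W at *
  have h8 : ∀ y : List β × α × σ, (enc y).size = esize y := fun _ => rfl
  have h9 : ∀ y : List β × α × σ, (enc y).snd.size = esize y.2 := fun _ => rfl
  rw [h8, h9]
  rw [esize_pair] at h5
  rw [esize_pair]
  simp only [esize_pair] at h5
  simp only [esize_pair]
  change esize a + (esize a + t + u) + _ ≤ _
  omega

theorem PolyTime.foldl {l : α → List β} {s : α → σ}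
    {g : α × β × σ → σ} (hl : PolyTime l) (hs : PolyTime s) (hg : PolyTime g)
    (r : Polynomial ℕ)
    (hr : ∀ a l₁ l₂, l a = l₁ ++ l₂ →
      esize (l₁.foldl (fun s b => g (a, b, s)) (s a)) ≤ r.eval (esize a)) :
    PolyTime (fun a => (l a).foldl (fun s b => g (a, b, s)) (s a)) :=
  CompIn.foldl hl hs hg r hr (by simp)

theorem PolyTime.any {l : α → List β} {g : α × β → Bool} (hl : PolyTime l) (hg : PolyTime g) :
    PolyTime (fun a => (l a).any (fun b => g (a, b))) := by
  have h : PolyTime (fun p : α × β × Bool => p.2.2 || g (p.1, p.2.1)) :=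
    (PolyTime.snd.comp .snd).or (hg.comp (PolyTime.fst.pair (PolyTime.fst.comp .snd)))
  refine CompIn.of_enc_eq (hl.foldl (.const false) h 3 fun a _ _ _ => ?_) fun a => ?_
  · simpa using esize_bool _
  · suffices ∀ c : Bool, (l a).foldl (fun s b => s || g (a, b)) c =
        (c || (l a).any (fun b => g (a, b))) by rw [this]; simp
    generalize l a = l'
    induction l' with
    | nil => simp
    | cons b l ih => intro c; simp [ih, Bool.or_assoc]

theorem PolyTime.all {l : α → List β} {g : α × β → Bool} (hl : PolyTime l) (hg : PolyTime g) :
    PolyTime (fun a => (l a).all (fun b => g (a, b))) := by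
  refine CompIn.of_enc_eq (hl.any hg.not).not fun a => ?_
  rw [List.all_eq_not_any_not]

theorem PolyTime.reverse {l : α → List β} (hl : PolyTime l) :
    PolyTime (fun a => (l a).reverse) := by
  refine PolyTime.comp (g := fun l : List β => l.reverse) ?_ hl
  have h : PolyTime (fun p : List β × β × List β => p.2.1 :: p.2.2) :=
    (PolyTime.fst.comp .snd).cons (PolyTime.snd.comp .snd)
  refine CompIn.of_enc_eq (PolyTime.id.foldl (.const []) h .X fun a l₁ l₂ e => ?_) fun a => ?_
  · rw [e]
    simpa [esize_reverse] using esize_sublist (List.sublist_append_left l₁ l₂)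
  · simp

theorem foldl_append_eq {κ : Type} (l₁ l₂ : List κ) :
    l₁.foldl (fun s b => b :: s) l₂ = l₁.reverse ++ l₂ := by
  induction l₁ generalizing l₂ with
  | nil => rfl
  | cons a l ih => simp [ih]

theorem PolyTime.append {f g : α → List β} (hf : PolyTime f) (hg : PolyTime g) :
    PolyTime (fun a => f a ++ g a) := by
  refine PolyTime.comp (g := fun p : List β × List β => p.1 ++ p.2) ?_ (hf.pair hg)
  have h : PolyTime (fun p : (List β × List β) × β × List β => p.2.1 :: p.2.2) :=
    (PolyTime.fst.comp .snd).cons (PolyTime.snd.comp .snd)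
  refine CompIn.of_enc_eq (PolyTime.fst.reverse.foldl .snd h .X fun a l₁ l₂ e => ?_) fun a => ?_
  · have h1 := esize_sublist (List.sublist_append_left l₁ l₂)
    rw [← e, esize_reverse] at h1
    have h2 := esize_append l₁.reverse a.2
    rw [esize_reverse] at h2
    have h3 : esize a = esize a.1 + esize a.2 + 1 := rfl
    simp only [foldl_append_eq, Polynomial.eval_X]
    omega
  · simp

theorem foldl_map_eq {κ κ' : Type} (f : κ → κ') (l : List κ) (s : List κ') :
    l.foldl (fun s b => f b :: s) s = (l.map f).reverse ++ s := by
  induction l generalizing s with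
  | nil => rfl
  | cons a l ih => simp [ih]

theorem PolyTime.map {l : α → List β} {g : α × β → γ} (hl : PolyTime l) (hg : PolyTime g) :
    PolyTime (fun a => (l a).map (fun b => g (a, b))) := by
  have h : PolyTime (fun p : α × β × List γ => g (p.1, p.2.1) :: p.2.2) :=
    (hg.comp (PolyTime.fst.pair (PolyTime.fst.comp .snd))).cons (PolyTime.snd.comp .snd)
  obtain ⟨ql, hql⟩ := hl.size_le
  obtain ⟨qg, hqg⟩ := hg.size_le
  refine CompIn.of_enc_eq (hl.foldl (.const []) h (ql * (qg.comp (.X + ql + 1) + 1) + 1)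
    fun a l₁ l₂ e => ?_).reverse fun a => ?_
  · rw [foldl_map_eq (fun b => g (a, b)), List.append_nil, esize_reverse]
    refine (esize_list_le (z := qg.eval (esize a + ql.eval (esize a) + 1)) fun c hc => ?_).trans ?_
    · obtain ⟨b, hb, rfl⟩ := List.mem_map.1 hc
      refine (hqg _).trans (eval_le_eval _ ?_)
      have h1 : esize b ≤ esize (l a) := esize_le_of_mem (by simp [e, hb])
      have h2 := hql a
      rw [esize_pair]; simp only [add_zero] at *; omega
    · have h1 := length_le_esize (l a)
      have h2 := hql a
      rw [e, List.length_append, ← e] at h1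
      simp only [Polynomial.eval_add, Polynomial.eval_X, Polynomial.eval_mul, Polynomial.eval_one,
        Polynomial.eval_comp, List.length_map, add_zero] at *
      exact Nat.succ_le_succ (Nat.mul_le_mul_right _ (by omega))
  · simp [foldl_map_eq (fun b => g (a, b))]

theorem foldl_filter_eq {κ : Type} (f : κ → Bool) (l s : List κ) :
    l.foldl (fun s b => if f b then b :: s else s) s = (l.filter f).reverse ++ s := by
  induction l generalizing s with
  | nil => rfl
  | cons a l ih => cases h : f a <;> simp [ih, h]

theorem CompIn.filter {w : α → ℕ} {w' : α × β → ℕ} {l : α → List β} {g : α × β → Bool}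
    (hl : CompIn w l) (hg : CompIn w' g) (hw : ∀ a, ∀ b ∈ l a, w' (a, b) ≤ w a) :
    CompIn w (fun a => (l a).filter (fun b => g (a, b))) := by
  have hc : CompIn (fun p : α × β × List β => w' (p.1, p.2.1))
      (fun p : α × β × List β => g (p.1, p.2.1)) :=
    hg.comp_polyTime (PolyTime.fst.pair (PolyTime.fst.comp .snd))
  have h := hc.ite (((PolyTime.fst.comp .snd).cons (PolyTime.snd.comp .snd)).compIn _)
    ((PolyTime.snd.comp .snd).compIn _)
  obtain ⟨ql, hql⟩ := hl.size_le
  refine CompIn.of_enc_eq (PolyTime.reverse .id |>.comp_compIn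
    (hl.foldl ((PolyTime.const []).compIn w) h (ql + .X)
    (fun a l₁ l₂ e => ?_) fun a l₁ b l₂ e => ?_)) fun a => ?_
  · rw [foldl_filter_eq (fun b => g (a, b)), List.append_nil, esize_reverse]
    refine (esize_sublist (List.filter_sublist.trans (List.sublist_append_left l₁ l₂))).trans ?_
    rw [← e, Polynomial.eval_add]
    exact (hql a).trans (Nat.le_add_right _ _)
  · have := hw a b (by simp [e])
    simp only [Polynomial.eval_add, Polynomial.eval_X]
    omega
  · simp [foldl_filter_eq (fun b => g (a, b))]

theorem PolyTime.filter {l : α → List β} {g : α × β → Bool}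
    (hl : PolyTime l) (hg : PolyTime g) :
    PolyTime (fun a => (l a).filter (fun b => g (a, b))) :=
  CompIn.filter hl hg (by simp)

theorem foldl_flatten_eq {κ : Type} (l : List (List κ)) (s : List κ) :
    l.foldl (fun s b => s ++ b) s = s ++ l.flatten := by
  induction l generalizing s with
  | nil => simp
  | cons a l ih => simp [ih]

theorem esize_flatten_le (l : List (List β)) : esize l.flatten ≤ esize l := by
  induction l with
  | nil => exact le_rfl
  | cons a l ih =>
    have := esize_append a l.flatten
    rw [List.flatten_cons, esize_cons]; omega

theorem PolyTime.flatten {l : α → List (List β)} (hl : PolyTime l) :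
    PolyTime (fun a => (l a).flatten) := by
  refine PolyTime.comp (g := fun l : List (List β) => l.flatten) ?_ hl
  have h : PolyTime (fun p : List (List β) × List β × List β => p.2.2 ++ p.2.1) :=
    (PolyTime.snd.comp .snd).append (PolyTime.fst.comp .snd)
  refine CompIn.of_enc_eq (PolyTime.id.foldl (.const []) h .X fun a l₁ l₂ e => ?_) fun a => ?_
  · simp only [foldl_flatten_eq, List.nil_append, Polynomial.eval_X]
    refine (esize_flatten_le l₁).trans ?_
    rw [e]
    exact esize_sublist (List.sublist_append_left l₁ l₂)
  · simp [foldl_flatten_eq]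

theorem PolyTime.flatMap {l : α → List β} {g : α × β → List γ} (hl : PolyTime l)
    (hg : PolyTime g) : PolyTime (fun a => (l a).flatMap (fun b => g (a, b))) :=
  (hl.map hg).flatten

/-! ### Numbers -/

/-- A unary number is the same tree as a list of units, so arithmetic and bounded iteration reduce
to list operations. -/
theorem enc_replicate (k : ℕ) : enc (List.replicate k ()) = enc k := by
  induction k with
  | zero => rfl
  | succ k ih => exact congrArg (Data.cons .nil) ih

theorem PolyTime.replicate {k : α → ℕ} (hk : PolyTime k) :
    PolyTime (fun a => List.replicate (k a) ()) :=
  CompIn.of_enc_eq hk fun _ => (enc_replicate _).symm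

theorem PolyTime.succ {k : α → ℕ} (hk : PolyTime k) : PolyTime (fun a => k a + 1) :=
  CompIn.of_enc_eq ((PolyTime.const ()).pair hk) fun _ => rfl

theorem foldl_drop_eq {κ : Type} (k : ℕ) (l : List κ) :
    (List.replicate k ()).foldl (fun s _ => s.tail) l = l.drop k := by
  induction k generalizing l with
  | zero => rfl
  | succ k ih => rw [List.replicate_succ, List.foldl_cons, ih, List.drop_tail]

theorem PolyTime.drop {k : α → ℕ} {l : α → List β} (hk : PolyTime k) (hl : PolyTime l) :
    PolyTime (fun a => (l a).drop (k a)) := by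
  have h : PolyTime (fun p : α × Unit × List β => p.2.2.tail) := (PolyTime.snd.comp .snd).tail
  obtain ⟨ql, hql⟩ := hl.size_le
  refine CompIn.of_enc_eq (hk.replicate.foldl hl h ql fun a l₁ l₂ e => ?_) fun a => ?_
  · obtain ⟨m, rfl⟩ : ∃ m, l₁ = List.replicate m () :=
      ⟨_, List.eq_replicate_length.2 fun _ _ => rfl⟩
    rw [foldl_drop_eq]
    exact (esize_sublist (List.drop_sublist _ _)).trans (hql a)
  · rw [foldl_drop_eq]

/-- Dropping `j` entries from a list of `k` units leaves something exactly when `j < k`. -/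
theorem PolyTime.lt {j k : α → ℕ} (hj : PolyTime j) (hk : PolyTime k) :
    PolyTime (fun a => decide (j a < k a)) := by
  refine CompIn.of_enc_eq (hj.drop hk.replicate).isEmpty.not fun a => ?_
  congr 1
  rw [List.drop_replicate, Bool.eq_iff_iff]
  simp
  omega

theorem PolyTime.natEq {j k : α → ℕ} (hj : PolyTime j) (hk : PolyTime k) :
    PolyTime (fun a => decide (j a = k a)) := by
  refine CompIn.of_enc_eq ((hj.lt hk).not.and (hk.lt hj).not) fun a => ?_
  congr 1
  rw [Bool.eq_iff_iff]
  simp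
  omega

theorem PolyTime.length {l : α → List β} (hl : PolyTime l) : PolyTime (fun a => (l a).length) := by
  have h := CompIn.of_enc_eq (hl.map (PolyTime.const ())) (g := fun a => (l a).length)
    fun a => by rw [← enc_replicate]; simp
  exact h

theorem PolyTime.listRange {k : α → ℕ} (hk : PolyTime k) :
    PolyTime (fun a => List.range (k a)) := by
  have h : PolyTime (fun p : α × Unit × List ℕ => 0 :: p.2.2.map (fun i => i + 1)) :=
    (PolyTime.const 0).cons ((PolyTime.snd.comp .snd).map PolyTime.snd.succ)
  have e : ∀ k, (List.replicate k ()).foldl (fun s _ => 0 :: s.map (fun i => i + 1)) ([] : List ℕ) =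
      List.range k := by
    intro k
    induction k with
    | zero => rfl
    | succ k ih => rw [List.replicate_succ', List.foldl_append, ih, List.range_succ_eq_map]; rfl
  obtain ⟨ql, hql⟩ := hk.size_le
  refine CompIn.of_enc_eq (hk.replicate.foldl (.const []) h (ql * (2 * ql + 2) + 1)
    fun a l₁ l₂ h1 => ?_) fun a => ?_
  · obtain ⟨m, rfl⟩ : ∃ m, l₁ = List.replicate m () :=
      ⟨_, List.eq_replicate_length.2 fun _ _ => rfl⟩
    rw [e]
    have h2 := congrArg List.length h1
    have h3 := hql a
    rw [esize_nat] at h3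
    simp only [List.length_replicate, List.length_append, add_zero] at h2 h3
    refine (esize_list_le (z := 2 * m + 1) fun i hi => ?_).trans ?_
    · rw [esize_nat]; rw [List.mem_range] at hi; omega
    · simp only [Polynomial.eval_add, Polynomial.eval_mul, Polynomial.eval_ofNat,
        Polynomial.eval_one, List.length_range]
      have : m ≤ ql.eval (esize a) := by omega
      exact Nat.succ_le_succ (Nat.mul_le_mul this (by omega))
  · rw [e]

theorem PolyTime.contains {i : α → ℕ} {l : α → List ℕ} (hl : PolyTime l) (hi : PolyTime i) :
    PolyTime (fun a => (l a).contains (i a)) := by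
  have h : PolyTime (fun p : α × ℕ => decide (i p.1 = p.2)) := (hi.comp .fst).natEq .snd
  refine CompIn.of_enc_eq (hl.any h) fun a => ?_
  congr 1
  rw [Bool.eq_iff_iff]
  simp

/-! ### The algorithm -/

/-- The increasing lists of `k` numbers below `n`. -/
def subs : ℕ → ℕ → List (List ℕ)
  | 0, _ => [[]]
  | k + 1, n => (List.range n).flatMap fun i =>
      ((subs k n).filter fun c => c.all fun j => decide (i < j)).map fun c => i :: c

/-- The entry of a matrix at `(i, j)`. -/
def entry (m : List (List Bool)) (i j : ℕ) : Bool :=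
  (((m.drop i).headD []).drop j).headD false

/-- Do the elements of `c` form a clique of the graph with adjacency matrix `m`? -/
def isCliqueList (m : List (List Bool)) (c : List ℕ) : Bool :=
  c.all fun i => c.all fun j => decide (i = j) || entry m i j

/-- The `d`-cliques of the graph with adjacency matrix `m`. -/
def cliqueList (d : ℕ) (m : List (List Bool)) : List (List ℕ) :=
  (subs d m.length).filter (isCliqueList m)

/-- Do two lists share at least two elements? -/
def shareTwo (c e : List ℕ) : Bool := !((c.filter fun i => e.contains i).drop 1).isEmpty

/-- Do two lists have the same elements? -/
def sameElems (c e : List ℕ) : Bool := (c.all fun i => e.contains i) && e.all fun i => c.contains i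

/-- One round of the search for the members of `K` linked to a member of `S`. -/
def grow (K S : List (List ℕ)) : List (List ℕ) := K.filter fun c => S.any fun s => shareTwo c s

/-- The members of `K` that can be reached from `h`. -/
def compList (K : List (List ℕ)) (h : List ℕ) : List (List ℕ) :=
  -- The elements of `K` serve only as a clock: `K.length` rounds suffice for every path in the
  -- component.
  K.foldl (fun S _ => grow K S) [h]

/-- Is every pair inside a member of `C` inside a member of `t`? -/
def covers (t C : List (List ℕ)) : Bool :=
  -- The case `i = j` adds no constraint when `2 ≤ d`, since each vertex of a hyperedge lies in a
  -- proper pair.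
  C.all fun c => c.all fun i => c.all fun j => t.any fun e => e.contains i && e.contains j

/-- The choice between a candidate and the best sublist found so far. -/
def better (C s t : List (List ℕ)) : List (List ℕ) :=
  if covers t C && decide (t.length < s.length) then t else s

/-- A shortest sublist of `C` that covers all the pairs inside members of `C`. -/
def best (C : List (List ℕ)) : List (List ℕ) := C.sublists'.foldl (better C) C

/-- Does the brute-force solution on the component of `h` contain `h`? -/
def keep (K : List (List ℕ)) (h : List ℕ) : Bool := (best (compList K h)).any (sameElems h)

/-- The reconstruction algorithm. -/
def reconstruct (d : ℕ) (m : List (List Bool)) : List (List ℕ) :=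
  (cliqueList d m).filter (keep (cliqueList d m))

/-! ### Running times -/

theorem PolyTime.subs (k : ℕ) {n : α → ℕ} (hn : PolyTime n) :
    PolyTime (fun a => subs k (n a)) := by
  induction k with
  | zero => exact .const [[]]
  | succ k ih =>
    have h1 : PolyTime (fun p : (α × ℕ) × List ℕ => p.2.all fun j => decide (p.1.2 < j)) :=
      PolyTime.snd.all (g := fun q : ((α × ℕ) × List ℕ) × ℕ => decide (q.1.1.2 < q.2))
        ((PolyTime.snd.comp (PolyTime.fst.comp .fst)).lt .snd)
    have h2 := (((ih.comp (PolyTime.fst (α := α) (β := ℕ))).filter h1).map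
      (g := fun q : (α × ℕ) × List ℕ => q.1.2 :: q.2)
      ((PolyTime.snd.comp .fst).cons .snd))
    exact hn.listRange.flatMap h2

theorem PolyTime.entry {m : α → List (List Bool)} {i j : α → ℕ} (hm : PolyTime m)
    (hi : PolyTime i) (hj : PolyTime j) : PolyTime (fun a => entry (m a) (i a) (j a)) :=
  (hj.drop ((hi.drop hm).headD [] rfl)).headD false rfl

theorem PolyTime.isCliqueList {m : α → List (List Bool)} {c : α → List ℕ} (hm : PolyTime m)
    (hc : PolyTime c) : PolyTime (fun a => isCliqueList (m a) (c a)) := by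
  have h1 : PolyTime (fun p : (α × ℕ) × ℕ =>
      decide (p.1.2 = p.2) || HypRec.entry (m p.1.1) p.1.2 p.2) :=
    ((PolyTime.snd.comp .fst).natEq .snd).or
      ((hm.comp (PolyTime.fst.comp .fst)).entry (PolyTime.snd.comp .fst) .snd)
  exact hc.all ((hc.comp PolyTime.fst).all h1)

theorem PolyTime.cliqueList (d : ℕ) : PolyTime (cliqueList d) :=
  (PolyTime.subs d (PolyTime.length .id)).filter (PolyTime.isCliqueList .fst .snd)

theorem PolyTime.shareTwo {c e : α → List ℕ} (hc : PolyTime c) (he : PolyTime e) :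
    PolyTime (fun a => shareTwo (c a) (e a)) := by
  have h1 : PolyTime (fun p : α × ℕ => (e p.1).contains p.2) := (he.comp .fst).contains .snd
  exact (PolyTime.drop (.const 1) (hc.filter h1)).isEmpty.not

theorem PolyTime.sameElems {c e : α → List ℕ} (hc : PolyTime c) (he : PolyTime e) :
    PolyTime (fun a => sameElems (c a) (e a)) := by
  have h1 : PolyTime (fun p : α × ℕ => (e p.1).contains p.2) := (he.comp .fst).contains .snd
  have h2 : PolyTime (fun p : α × ℕ => (c p.1).contains p.2) := (hc.comp .fst).contains .snd
  exact (hc.all h1).and (he.all h2)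

theorem PolyTime.grow {K S : α → List (List ℕ)} (hK : PolyTime K) (hS : PolyTime S) :
    PolyTime (fun a => grow (K a) (S a)) := by
  have h1 : PolyTime (fun p : (α × List ℕ) × List ℕ => HypRec.shareTwo p.1.2 p.2) :=
    (PolyTime.snd.comp .fst).shareTwo .snd
  exact hK.filter ((hS.comp PolyTime.fst).any h1)

/-- After any round the state is a sublist of `K`, so it never outgrows the input; `+ 2` covers the
initial singleton. -/
theorem PolyTime.compList : PolyTime (fun p : List (List ℕ) × List ℕ => compList p.1 p.2) := by
  have h : PolyTime (fun q : (List (List ℕ) × List ℕ) × List ℕ × List (List ℕ) =>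
      HypRec.grow q.1.1 q.2.2) := (PolyTime.fst.comp .fst).grow (PolyTime.snd.comp .snd)
  refine PolyTime.fst.foldl (PolyTime.snd.cons (.const [])) h (.X + 2) fun a l₁ l₂ _ => ?_
  have h1 : esize a = esize a.1 + esize a.2 + 1 := rfl
  have h2 : esize [a.2] = esize a.2 + 1 + 1 := rfl
  simp only [Polynomial.eval_add, Polynomial.eval_X, Polynomial.eval_ofNat]
  induction l₁ using List.reverseRecOn with
  | nil => rw [List.foldl_nil]; omega
  | append_singleton l b _ =>
    rw [List.foldl_append, List.foldl_cons, List.foldl_nil]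
    refine (esize_sublist (List.filter_sublist (l := a.1))).trans ?_
    omega

theorem PolyTime.covers {t C : α → List (List ℕ)} (ht : PolyTime t) (hC : PolyTime C) :
    PolyTime (fun a => covers (t a) (C a)) := by
  have h0 : PolyTime (fun p : (((α × List ℕ) × ℕ) × ℕ) × List ℕ =>
      p.2.contains p.1.1.2 && p.2.contains p.1.2) :=
    (PolyTime.snd.contains (PolyTime.snd.comp (PolyTime.fst.comp .fst))).and
      (PolyTime.snd.contains (PolyTime.snd.comp .fst))
  have h1 : PolyTime (fun p : ((α × List ℕ) × ℕ) × ℕ =>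
      (t p.1.1.1).any fun e => e.contains p.1.2 && e.contains p.2) :=
    (ht.comp (PolyTime.fst.comp (PolyTime.fst.comp .fst))).any h0
  have h2 : PolyTime (fun p : (α × List ℕ) × ℕ => p.1.2.all fun j =>
      (t p.1.1).any fun e => e.contains p.2 && e.contains j) :=
    (PolyTime.snd.comp .fst).all h1
  have h3 : PolyTime (fun p : α × List ℕ => p.2.all fun i => p.2.all fun j =>
      (t p.1).any fun e => e.contains i && e.contains j) := PolyTime.snd.all h2
  exact hC.all h3

theorem esize_sublists_le (C : List (List ℕ)) (l : List (List ℕ))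
    (h : l.Sublist C) : esize l.sublists' ≤ 2 ^ C.length * (esize C + 1) + 1 := by
  refine (esize_list_le (z := esize C) fun a ha => ?_).trans ?_
  · exact esize_sublist ((List.mem_sublists'.1 ha).trans h)
  · rw [List.length_sublists']
    exact Nat.succ_le_succ (Nat.mul_le_mul_right _ (Nat.pow_le_pow_right (by simp) h.length_le))

/-- The output is exponentially long, but polynomial in the size plus the weight, the weight being
the number of sublists. -/
theorem CompIn.sublists' :
    CompIn (fun C : List (List ℕ) => 2 ^ C.length) (fun C : List (List ℕ) => C.sublists') := by
  have h1 : PolyTime (fun q : List (List ℕ) × List ℕ × List (List (List ℕ)) =>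
      q.2.2 ++ q.2.2.map fun s => q.2.1 :: s) := by
    have h2 : PolyTime (fun q : (List (List ℕ) × List ℕ × List (List (List ℕ))) × List (List ℕ) =>
      q.1.2.1 :: q.2) := (PolyTime.fst.comp (PolyTime.snd.comp .fst)).cons .snd
    exact (PolyTime.snd.comp .snd).append ((PolyTime.snd.comp .snd).map h2)
  have e : ∀ l : List (List ℕ), l.foldl (fun q b => q ++ q.map fun s => b :: s) [[]] =
      l.reverse.sublists' := by
    intro l
    induction l using List.reverseRecOn with
    | nil => rfl
    | append_singleton l b ih =>
      rw [List.foldl_append, ih, List.reverse_append, List.reverse_singleton,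
        List.singleton_append, List.sublists'_cons]
      rfl
  -- `sublists'` recurses on the tail, so the fold has to consume the list from its end.
  refine CompIn.of_enc_eq (((PolyTime.reverse .id).compIn _).foldl ((PolyTime.const [[]]).compIn _)
    h1 (.X * (.X + 1) + 1) (fun a l₁ l₂ h => ?_) (by simp)) fun a => ?_
  · rw [e]
    have h2 : l₁.reverse.Sublist a := by
      rw [← List.reverse_reverse a, h, List.reverse_append]
      exact List.sublist_append_right _ _
    refine (esize_sublists_le _ _ h2).trans ?_
    simp only [Polynomial.eval_add, Polynomial.eval_mul, Polynomial.eval_X, Polynomial.eval_one]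
    gcongr
    · exact Nat.le_add_left _ _
    · exact Nat.le_add_right _ _
  · rw [e, List.reverse_reverse]

/-- The state is always one of the candidates. This bounds its size during the fold and shows that
`best C` is a sublist of `C`. -/
theorem foldl_better_mem (C s : List (List ℕ)) (L : List (List (List ℕ))) :
    L.foldl (better C) s = s ∨ L.foldl (better C) s ∈ L := by
  induction L generalizing s with
  | nil => exact .inl rfl
  | cons t L ih =>
    rw [List.foldl_cons, List.mem_cons]
    rcases ih (better C s t) with h | h
    · rw [h, better]
      split
      · exact .inr (.inl rfl)
      · exact .inl rfl
    · exact .inr (.inr h)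

theorem CompIn.best : CompIn (fun C : List (List ℕ) => 2 ^ C.length) best := by
  have h1 : PolyTime (fun q : (List (List ℕ) × List (List (List ℕ))) × List (List ℕ) ×
      List (List ℕ) => better q.1.1 q.2.2 q.2.1) := by
    have ht : PolyTime (fun q : (List (List ℕ) × List (List (List ℕ))) × List (List ℕ) ×
      List (List ℕ) => q.2.1) := PolyTime.fst.comp .snd
    have hs : PolyTime (fun q : (List (List ℕ) × List (List (List ℕ))) × List (List ℕ) ×
      List (List ℕ) => q.2.2) := PolyTime.snd.comp .snd
    exact ((ht.covers (PolyTime.fst.comp .fst)).and (ht.length.lt hs.length)).ite ht hs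
  have h2 : PolyTime (fun p : List (List ℕ) × List (List (List ℕ)) =>
      p.2.foldl (better p.1) p.1) := by
    refine PolyTime.snd.foldl .fst h1 .X fun a l₁ l₂ h => ?_
    have h3 : esize a = esize a.1 + esize a.2 + 1 := rfl
    rw [Polynomial.eval_X]
    rcases foldl_better_mem a.1 a.1 l₁ with h4 | h4
    · change esize (l₁.foldl (better a.1) a.1) ≤ _
      rw [h4]; omega
    · have := esize_le_of_mem (l := a.2) (by rw [h]; exact List.mem_append_left _ h4)
      change esize (l₁.foldl (better a.1) a.1) ≤ _
      omega
  exact h2.comp_compIn ((PolyTime.id.compIn _).pair CompIn.sublists')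

theorem CompIn.keep :
    CompIn (fun p : List (List ℕ) × List ℕ => 2 ^ (HypRec.compList p.1 p.2).length)
    (fun p => keep p.1 p.2) := by
  have h1 := CompIn.best.comp_polyTime PolyTime.compList
  have h2 : PolyTime (fun p : List ℕ × List (List ℕ) => p.2.any (sameElems p.1)) :=
    PolyTime.snd.any (PolyTime.sameElems (PolyTime.fst.comp .fst) .snd)
  exact h2.comp_compIn ((PolyTime.snd.compIn _).pair h1)

/-- The total number of sublists inspected by the brute-force searches. -/
def searchCost (K : List (List ℕ)) : ℕ := (K.map fun h => 2 ^ (compList K h).length).sum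

theorem CompIn.reconstruct (d : ℕ) :
    CompIn (fun m => searchCost (HypRec.cliqueList d m)) (reconstruct d) := by
  have h : CompIn searchCost (fun K : List (List ℕ) => K.filter (HypRec.keep K)) :=
    -- The weight of a single search is one term of the sum `searchCost`.
    CompIn.filter (w := searchCost) (PolyTime.id.compIn _) CompIn.keep fun a b hb =>
      List.single_le_sum (by simp) _
        (List.mem_map_of_mem (f := fun h => 2 ^ (HypRec.compList a h).length) hb)
  exact h.comp_polyTime (PolyTime.cliqueList d)

/-! ### Hyperedges as increasing lists -/

section Lists

variable {n : ℕ}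

/-- The increasing list of the vertices of a hyperedge. -/
def edgeList (h : Finset (Fin n)) : List ℕ := (h.sort (· ≤ ·)).map Fin.val

/-- The set of the vertices in a list. -/
def toEdge (n : ℕ) (c : List ℕ) : Finset (Fin n) := Finset.univ.filter fun i => i.val ∈ c

theorem mem_toEdge {c : List ℕ} {i : Fin n} : i ∈ toEdge n c ↔ i.val ∈ c := by
  simp [toEdge]

theorem mem_edgeList {h : Finset (Fin n)} {k : ℕ} : k ∈ edgeList h ↔ ∃ i ∈ h, i.val = k := by
  simp [edgeList]

theorem val_mem_edgeList {h : Finset (Fin n)} {i : Fin n} : i.val ∈ edgeList h ↔ i ∈ h := by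
  simp [edgeList, Fin.val_inj]

theorem toEdge_edgeList (h : Finset (Fin n)) : toEdge n (edgeList h) = h := by
  ext i
  rw [mem_toEdge, val_mem_edgeList]

theorem edgeList_injective : Function.Injective (edgeList (n := n)) :=
  Function.LeftInverse.injective toEdge_edgeList

theorem length_edgeList (h : Finset (Fin n)) : (edgeList h).length = h.card := by
  simp [edgeList]

theorem pairwise_edgeList (h : Finset (Fin n)) : (edgeList h).Pairwise (· < ·) :=
  List.Pairwise.map _ (fun _ _ hab => hab) (Finset.sortedLT_sort h).pairwise

theorem enc_edgeList (h : Finset (Fin n)) : enc (edgeList h) = encodeEdge h := by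
  change Data.ofList (((h.sort (· ≤ ·)).map Fin.val).map Data.ofNat) = _
  rw [List.map_map]; rfl

theorem edgeList_toEdge {c : List ℕ} (h1 : c.Pairwise (· < ·)) (h2 : ∀ i ∈ c, i < n) :
    edgeList (toEdge n c) = c := by
  refine (pairwise_edgeList _).eq_of_mem_iff h1 fun i => ?_
  rw [mem_edgeList]
  constructor
  · rintro ⟨j, hj, rfl⟩
    exact mem_toEdge.1 hj
  · intro hi
    exact ⟨⟨i, h2 i hi⟩, mem_toEdge.2 hi, rfl⟩

theorem mem_subs {k n : ℕ} {c : List ℕ} :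
    c ∈ subs k n ↔ c.Pairwise (· < ·) ∧ c.length = k ∧ ∀ i ∈ c, i < n := by
  induction k generalizing c with
  | zero =>
    simp only [subs, List.mem_singleton, List.length_eq_zero_iff]
    constructor
    · rintro rfl; simp
    · exact fun h => h.2.1
  | succ k ih =>
    simp only [subs, List.mem_flatMap, List.mem_map, List.mem_filter, ih, List.mem_range,
      List.all_eq_true, decide_eq_true_eq]
    constructor
    · rintro ⟨i, hi, c, ⟨⟨h1, h2, h3⟩, h4⟩, rfl⟩
      refine ⟨List.pairwise_cons.2 ⟨h4, h1⟩, by simp [h2], ?_⟩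
      simpa using ⟨hi, h3⟩
    · rintro ⟨h1, h2, h3⟩
      cases c with
      | nil => simp at h2
      | cons i c =>
        rw [List.pairwise_cons] at h1
        exact ⟨i, h3 i (by simp), c, ⟨⟨h1.2, by simpa using h2, fun j hj => h3 j (by simp [hj])⟩,
          h1.1⟩, rfl⟩

theorem nodup_subs (k n : ℕ) : (subs k n).Nodup := by
  induction k with
  | zero => simp [subs]
  | succ k ih =>
    rw [subs, List.nodup_flatMap]
    refine ⟨fun i _ => (ih.filter _).map fun a b h => by simpa using h, ?_⟩
    refine List.nodup_range.imp ?_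
    intro i j hij
    rw [Function.onFun, List.disjoint_left]
    intro c hc hc'
    obtain ⟨a, _, rfl⟩ := List.mem_map.1 hc
    obtain ⟨b, _, h⟩ := List.mem_map.1 hc'
    exact hij (List.cons_eq_cons.1 h).1.symm

/-- All the `d`-subsets of `[n]`, in lexicographic order. -/
def allEdges (d n : ℕ) : List (Finset (Fin n)) := (subs d n).map (toEdge n)

/-- An equality of lists, order included: the solution returned by `best` may depend on the order of
its input. -/
theorem map_edgeList_allEdges (d n : ℕ) : (allEdges d n).map edgeList = subs d n := by
  rw [allEdges, List.map_map]
  refine (List.map_congr_left fun c hc => ?_).trans (List.map_id _)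
  obtain ⟨h1, -, h3⟩ := mem_subs.1 hc
  exact edgeList_toEdge h1 h3

theorem mem_allEdges {d : ℕ} {h : Finset (Fin n)} : h ∈ allEdges d n ↔ h.card = d := by
  rw [← List.mem_map_of_injective edgeList_injective, map_edgeList_allEdges, mem_subs]
  constructor
  · rintro ⟨-, h, -⟩
    rwa [length_edgeList] at h
  · rintro rfl
    refine ⟨pairwise_edgeList h, length_edgeList h, fun i hi => ?_⟩
    obtain ⟨j, -, rfl⟩ := mem_edgeList.1 hi
    exact j.2

theorem nodup_allEdges (d n : ℕ) : (allEdges d n).Nodup := by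
  have := nodup_subs d n
  rw [← map_edgeList_allEdges] at this
  exact this.of_map _

/-- The hyperedges with `d` vertices of a hypergraph, in lexicographic order. -/
def hypList (d : ℕ) (H : Hyp n) : List (Finset (Fin n)) := (allEdges d n).filter (· ∈ H)

theorem mem_hypList {d : ℕ} {H : Hyp n} (hH : Uniform d H) {h : Finset (Fin n)} :
    h ∈ hypList d H ↔ h ∈ H := by
  simp only [hypList, List.mem_filter, mem_allEdges, decide_eq_true_eq]
  exact ⟨fun h => h.2, fun h' => ⟨hH h h', h'⟩⟩

theorem nodup_hypList (d : ℕ) (H : Hyp n) : (hypList d H).Nodup := (nodup_allEdges d n).filter _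

theorem toFinset_hypList {d : ℕ} {H : Hyp n} (hH : Uniform d H) : (hypList d H).toFinset = H := by
  ext h
  rw [List.mem_toFinset, mem_hypList hH]

theorem length_hypList {d : ℕ} {H : Hyp n} (hH : Uniform d H) :
    (hypList d H).length = H.card := by
  rw [← List.toFinset_card_of_nodup (nodup_hypList d H), toFinset_hypList hH]

theorem hypList_sublist {d : ℕ} {H K : Hyp n} (h : H ⊆ K) :
    (hypList d H).Sublist (hypList d K) :=
  List.monotone_filter_right _ fun a ha => by
    simp only [decide_eq_true_eq] at *
    exact h ha

/-! ### The subroutines -/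

theorem shareTwo_edgeList (c e : Finset (Fin n)) :
    shareTwo (edgeList c) (edgeList e) = true ↔ 2 ≤ (c ∩ e).card := by
  have h1 : ((edgeList c).filter fun i => (edgeList e).contains i) = edgeList (c ∩ e) := by
    refine ((pairwise_edgeList c).filter _).eq_of_mem_iff (pairwise_edgeList _) fun k => ?_
    simp only [List.mem_filter, List.contains_eq_mem, decide_eq_true_eq]
    constructor
    · rintro ⟨h, h'⟩
      obtain ⟨i, hi, rfl⟩ := mem_edgeList.1 h
      exact val_mem_edgeList.2 (Finset.mem_inter.2 ⟨hi, val_mem_edgeList.1 h'⟩)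
    · intro h
      obtain ⟨i, hi, rfl⟩ := mem_edgeList.1 h
      rw [Finset.mem_inter] at hi
      exact ⟨val_mem_edgeList.2 hi.1, val_mem_edgeList.2 hi.2⟩
  rw [shareTwo, h1, ← length_edgeList]
  generalize edgeList (c ∩ e) = l
  rw [Bool.not_eq_true', List.isEmpty_eq_false_iff, Ne, List.drop_eq_nil_iff]
  omega

theorem sameElems_edgeList (c e : Finset (Fin n)) :
    sameElems (edgeList c) (edgeList e) = true ↔ c = e := by
  simp only [sameElems, Bool.and_eq_true, List.all_eq_true, List.contains_eq_mem,
    decide_eq_true_eq]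
  constructor
  · rintro ⟨h1, h2⟩
    ext i
    exact ⟨fun h => val_mem_edgeList.1 (h1 _ (val_mem_edgeList.2 h)),
      fun h => val_mem_edgeList.1 (h2 _ (val_mem_edgeList.2 h))⟩
  · rintro rfl
    exact ⟨fun _ h => h, fun _ h => h⟩

theorem covers_edgeList (T C : List (Finset (Fin n))) :
    covers (T.map edgeList) (C.map edgeList) = true ↔
      ∀ c ∈ C, ∀ i ∈ c, ∀ j ∈ c, ∃ e ∈ T, i ∈ e ∧ j ∈ e := by
  simp only [covers, List.all_eq_true, List.any_eq_true, List.mem_map, Bool.and_eq_true,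
    List.contains_eq_mem, decide_eq_true_eq, forall_exists_index, and_imp,
    forall_apply_eq_imp_iff₂, mem_edgeList, exists_exists_and_eq_and, Fin.val_inj, exists_eq_right]

/-- Because the initial list covers, covering is an invariant of the fold, and the length can only
decrease. -/
theorem foldl_better_spec (C s : List (List ℕ)) (L : List (List (List ℕ)))
    (hs : covers s C = true) :
    covers (L.foldl (better C) s) C = true ∧ (L.foldl (better C) s).length ≤ s.length ∧
      ∀ t ∈ L, covers t C = true → (L.foldl (better C) s).length ≤ t.length := by
  induction L generalizing s with
  | nil => simpa
  | cons t L ih =>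
    rw [List.foldl_cons]
    have h1 : covers (better C s t) C = true ∧ (better C s t).length ≤ s.length ∧
        (covers t C = true → (better C s t).length ≤ t.length) := by
      rw [better]
      split
      · next h =>
        rw [Bool.and_eq_true, decide_eq_true_eq] at h
        exact ⟨h.1, h.2.le, fun _ => le_rfl⟩
      · next h =>
        rw [Bool.and_eq_true, decide_eq_true_eq, not_and, not_lt] at h
        exact ⟨hs, le_rfl, h⟩
    obtain ⟨h2, h3, h4⟩ := ih _ h1.1
    refine ⟨h2, h3.trans h1.2.1, fun u hu hc => ?_⟩
    rcases List.mem_cons.1 hu with rfl | hu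
    · exact h3.trans (h1.2.2 hc)
    · exact h4 u hu hc

/-- Sublists of `C.map edgeList` are the images of sublists of `C`, which carries optimality from
lists of numbers back to hyperedges. -/
theorem exists_best (C : List (Finset (Fin n))) :
    ∃ T : List (Finset (Fin n)), best (C.map edgeList) = T.map edgeList ∧ T.Sublist C ∧
      (∀ c ∈ C, ∀ i ∈ c, ∀ j ∈ c, ∃ e ∈ T, i ∈ e ∧ j ∈ e) ∧
      ∀ T' : List (Finset (Fin n)), T'.Sublist C →
        (∀ c ∈ C, ∀ i ∈ c, ∀ j ∈ c, ∃ e ∈ T', i ∈ e ∧ j ∈ e) → T.length ≤ T'.length := by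
  have h1 : (best (C.map edgeList)).Sublist (C.map edgeList) := by
    rcases foldl_better_mem (C.map edgeList) (C.map edgeList) (C.map edgeList).sublists' with h | h
    · rw [best, h]
    · exact List.mem_sublists'.1 h
  obtain ⟨T, hT, hT'⟩ := List.sublist_map_iff.1 h1
  obtain ⟨h2, -, h3⟩ := foldl_better_spec (C.map edgeList) (C.map edgeList)
    (C.map edgeList).sublists' ((covers_edgeList C C).2 fun c hc i hi j hj => ⟨c, hc, hi, hj⟩)
  change covers (best _) _ = true at h2
  refine ⟨T, hT', hT, (covers_edgeList T C).1 (hT' ▸ h2), fun T' h4 h5 => ?_⟩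
  have h6 := h3 (T'.map edgeList) (List.mem_sublists'.2 (h4.map _)) ((covers_edgeList T' C).2 h5)
  change (best _).length ≤ _ at h6
  simpa [hT'] using h6

/-- The adjacency matrix of a graph. -/
noncomputable def adjMatrix (G : SimpleGraph (Fin n)) : List (List Bool) :=
  open scoped Classical in List.ofFn fun i : Fin n => List.ofFn fun j : Fin n => decide (G.Adj i j)

theorem enc_adjMatrix (G : SimpleGraph (Fin n)) : enc (adjMatrix G) = encodeGraph G := by
  change Data.ofList ((adjMatrix G).map enc) = _
  rw [adjMatrix, encodeGraph, List.map_ofFn]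
  congr 2
  funext i
  change Data.ofList ((List.ofFn _).map enc) = _
  rw [List.map_ofFn]
  congr 2
  funext j
  by_cases h : G.Adj i j <;> simp [Data.ofProp, enc, h]

theorem length_adjMatrix (G : SimpleGraph (Fin n)) : (adjMatrix G).length = n := by
  simp [adjMatrix]

theorem entry_adjMatrix (G : SimpleGraph (Fin n)) (i j : Fin n) :
    entry (adjMatrix G) i j = true ↔ G.Adj i j := by
  simp [entry, adjMatrix, List.headD_eq_head?_getD, List.head?_drop]

theorem mem_cliqueHyp {d : ℕ} {G : SimpleGraph (Fin n)} {h : Finset (Fin n)} :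
    h ∈ cliqueHyp d G ↔ h.card = d ∧ ∀ i ∈ h, ∀ j ∈ h, i ≠ j → G.Adj i j := by
  classical
  rw [cliqueHyp, SimpleGraph.mem_cliqueFinset_iff, SimpleGraph.isNClique_iff,
    SimpleGraph.isClique_iff, and_comm]
  exact and_congr_right fun _ => ⟨fun h i hi j hj => h hi hj, fun h i hi j hj => h i hi j hj⟩

theorem cliqueList_adjMatrix (d : ℕ) (G : SimpleGraph (Fin n)) :
    cliqueList d (adjMatrix G) = (hypList d (cliqueHyp d G)).map edgeList := by
  rw [cliqueList, length_adjMatrix, ← map_edgeList_allEdges, List.filter_map, hypList]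
  congr 1
  refine List.filter_congr fun h hh => ?_
  rw [Bool.eq_iff_iff, decide_eq_true_eq, mem_cliqueHyp]
  simp only [Function.comp, isCliqueList, List.all_eq_true, mem_edgeList, forall_exists_index,
    and_imp, forall_apply_eq_imp_iff₂, Bool.or_eq_true, decide_eq_true_eq, entry_adjMatrix,
    Fin.val_inj, mem_allEdges.1 hh, true_and]
  exact forall₄_congr fun i _ j _ => by tauto

theorem uniform_cliqueHyp (d : ℕ) (G : SimpleGraph (Fin n)) : Uniform d (cliqueHyp d G) :=
  fun _ h => (mem_cliqueHyp.1 h).1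

/-! ### Components -/

/-- Two hyperedges in the same 2-connected component. -/
def Linked (H : Hyp n) (h c : Finset (Fin n)) : Prop :=
  ∃ (hh : h ∈ H) (hc : c ∈ H), (twoNeighborGraph H).Reachable ⟨h, hh⟩ ⟨c, hc⟩

theorem Linked.refl {H : Hyp n} {h : Finset (Fin n)} (hh : h ∈ H) : Linked H h h :=
  ⟨hh, hh, .rfl⟩

theorem Linked.symm {H : Hyp n} {h c : Finset (Fin n)} (hl : Linked H h c) : Linked H c h :=
  let ⟨a, b, r⟩ := hl; ⟨b, a, r.symm⟩

theorem Linked.trans {H : Hyp n} {h c e : Finset (Fin n)} (h1 : Linked H h c)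
    (h2 : Linked H c e) : Linked H h e :=
  let ⟨a, _, r⟩ := h1; let ⟨_, b, r'⟩ := h2; ⟨a, b, r.trans r'⟩

theorem Linked.of_inter {H : Hyp n} {h c : Finset (Fin n)} (hh : h ∈ H) (hc : c ∈ H)
    (h2 : 2 ≤ (h ∩ c).card) : Linked H h c := by
  by_cases e : h = c
  · subst e; exact .refl hh
  · exact ⟨hh, hc, SimpleGraph.Adj.reachable ⟨fun h => e (congrArg Subtype.val h), h2⟩⟩

/-- The 2-connected component of `h`. -/
noncomputable def component (H : Hyp n) (h : Finset (Fin n)) : Hyp n :=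
  open scoped Classical in H.filter (Linked H h)

theorem mem_component {H : Hyp n} {h c : Finset (Fin n)} : c ∈ component H h ↔ Linked H h c := by
  simp only [component, Finset.mem_filter, and_iff_right_iff_imp]
  exact fun h => h.2.1

theorem component_subset (H : Hyp n) (h : Finset (Fin n)) : component H h ⊆ H := by
  classical exact Finset.filter_subset _ _

theorem isTwoComponent_iff {H C : Hyp n} :
    IsTwoComponent H C ↔ ∃ h ∈ H, C = component H h := by
  constructor
  · rintro ⟨c, hc⟩
    induction c using SimpleGraph.ConnectedComponent.ind with
    | h v =>
      refine ⟨v.1, v.2, ?_⟩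
      ext e
      rw [hc, mem_component]
      constructor
      · rintro ⟨he, h⟩
        exact ⟨v.2, he, (SimpleGraph.ConnectedComponent.exact h).symm⟩
      · rintro ⟨_, he, h⟩
        exact ⟨he, SimpleGraph.ConnectedComponent.sound h.symm⟩
  · rintro ⟨h, hh, rfl⟩
    refine ⟨(twoNeighborGraph H).connectedComponentMk ⟨h, hh⟩, fun e => ?_⟩
    rw [mem_component]
    constructor
    · rintro ⟨_, he, h⟩
      exact ⟨he, SimpleGraph.ConnectedComponent.sound h.symm⟩
    · rintro ⟨he, h⟩
      exact ⟨hh, he, (SimpleGraph.ConnectedComponent.exact h).symm⟩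

/-- Soundness and completeness of the search after `l.length` rounds. Walks end at `h`, so peeling
off the first step leaves a shorter walk from a neighbour of `e`. -/
theorem mem_foldl_grow {d : ℕ} (hd : 2 ≤ d) {H : Hyp n} (hH : Uniform d H) {h : Finset (Fin n)}
    (hh : h ∈ H) (l : List (List ℕ)) :
    let S := l.foldl (fun S _ => grow ((hypList d H).map edgeList) S) [edgeList h]
    (∀ c ∈ S, ∃ e, edgeList e = c ∧ Linked H h e) ∧
    ∀ (e : {e // e ∈ H}) (p : (twoNeighborGraph H).Walk e ⟨h, hh⟩), p.length ≤ l.length →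
      edgeList e.1 ∈ S := by
  induction l using List.reverseRecOn with
  | nil =>
    refine ⟨?_, fun e p hp => ?_⟩
    · simp only [List.foldl_nil, List.mem_singleton, forall_eq]
      exact ⟨h, rfl, .refl hh⟩
    · have := SimpleGraph.Walk.eq_of_length_eq_zero (Nat.le_zero.1 hp)
      simp [this]
  | append_singleton l b ih =>
    simp only [List.foldl_append, List.foldl_cons, List.foldl_nil] at ih ⊢
    set S := l.foldl (fun S _ => grow ((hypList d H).map edgeList) S) [edgeList h]
    have key : ∀ e ∈ H, ∀ c ∈ H, edgeList c ∈ S → 2 ≤ (e ∩ c).card →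
        edgeList e ∈ grow ((hypList d H).map edgeList) S := by
      intro e he c hc hcS h2
      rw [grow, List.mem_filter, List.any_eq_true]
      exact ⟨List.mem_map_of_mem ((mem_hypList hH).2 he), _, hcS, (shareTwo_edgeList e c).2 h2⟩
    refine ⟨fun c hc => ?_, fun e p hp => ?_⟩
    · rw [grow, List.mem_filter, List.any_eq_true] at hc
      obtain ⟨hc, s, hs, hcs⟩ := hc
      obtain ⟨e, he, rfl⟩ := List.mem_map.1 hc
      obtain ⟨f, rfl, hf⟩ := ih.1 s hs
      refine ⟨e, rfl, hf.trans (Linked.of_inter hf.2.1 ((mem_hypList hH).1 he) ?_)⟩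
      rw [Finset.inter_comm]
      exact (shareTwo_edgeList e f).1 hcs
    · cases p with
      | nil =>
        -- `h` is not lost in a new round: it shares `d ≥ 2` vertices with itself.
        refine key h hh h hh (ih.2 ⟨h, hh⟩ .nil (Nat.zero_le _)) ?_
        rw [Finset.inter_self, hH h hh]; exact hd
      | @cons _ v _ hadj p =>
        refine key e e.2 v v.2 (ih.2 v p ?_) hadj.2
        simpa using hp

/-- The result is listed in the order of `hypList`, whatever the starting hyperedge. All members of
a component thus trigger the same brute-force search, and their separate `keep` tests are
consistent. -/
theorem compList_edgeList {d : ℕ} (hd : 2 ≤ d) {H : Hyp n} (hH : Uniform d H)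
    {h : Finset (Fin n)} (hh : h ∈ H) :
    compList ((hypList d H).map edgeList) (edgeList h) =
      (hypList d (component H h)).map edgeList := by
  obtain ⟨h1, h2⟩ := mem_foldl_grow hd hH hh ((hypList d H).map edgeList)
  change (∀ c ∈ compList _ _, _) at h1
  change ∀ (e : {e // e ∈ H}) (p : (twoNeighborGraph H).Walk e ⟨h, hh⟩), _ →
    edgeList e.1 ∈ compList _ _ at h2
  have h3 : ∀ e ∈ H, edgeList e ∈ compList ((hypList d H).map edgeList) (edgeList h) ↔
      e ∈ component H h := by
    intro e he
    rw [mem_component]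
    constructor
    · intro h4
      obtain ⟨f, h5, h6⟩ := h1 _ h4
      rwa [← edgeList_injective h5]
    · rintro ⟨_, _, hr⟩
      obtain ⟨p, hp⟩ := hr.symm.exists_isPath
      refine h2 ⟨e, he⟩ p ?_
      have := hp.length_lt
      rw [List.length_map, length_hypList hH]
      simpa using this.le
  -- The list is nonempty, so at least one round takes place, and the last round filters it; this
  -- fixes the order.
  have h4 : ∃ P : List ℕ → Bool, compList ((hypList d H).map edgeList) (edgeList h) =
      ((hypList d H).map edgeList).filter P := by
    rw [compList]
    rcases List.eq_nil_or_concat ((hypList d H).map edgeList) with h5 | ⟨l, b, h5⟩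
    · have := (mem_hypList hH).2 hh
      rw [List.map_eq_nil_iff.1 h5] at this
      simp at this
    · nth_rw 2 [h5]
      rw [List.concat_eq_append, List.foldl_append, List.foldl_cons, List.foldl_nil, grow]
      exact ⟨_, rfl⟩
  obtain ⟨P, hP⟩ := h4
  have h6 : hypList d (component H h) = (hypList d H).filter (· ∈ component H h) := by
    rw [hypList, hypList, List.filter_filter]
    refine List.filter_congr fun e _ => ?_
    rw [Bool.eq_iff_iff, Bool.and_eq_true, decide_eq_true_eq, decide_eq_true_eq]
    exact ⟨fun he => ⟨he, component_subset H h he⟩, fun he => he.1⟩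
  rw [hP, List.filter_map, h6]
  congr 1
  refine List.filter_congr fun e he => ?_
  have h7 := h3 e ((mem_hypList hH).1 he)
  rw [hP, List.mem_filter] at h7
  rw [Bool.eq_iff_iff, decide_eq_true_eq, ← h7]
  exact ⟨fun h => ⟨List.mem_map_of_mem he, h⟩, fun h => h.2⟩

end Lists

/-! ### Minimum preimages -/

section Preimages

variable {n d : ℕ}

theorem two_le_card_inter {c e : Finset (Fin n)} {i j : Fin n} (hij : i ≠ j) (h1 : i ∈ c)
    (h2 : j ∈ c) (h3 : i ∈ e) (h4 : j ∈ e) : 2 ≤ (c ∩ e).card :=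
  Finset.one_lt_card.2 ⟨i, Finset.mem_inter.2 ⟨h1, h3⟩, j, Finset.mem_inter.2 ⟨h2, h4⟩, hij⟩

theorem IsPreimage.subset_cliqueHyp {G : SimpleGraph (Fin n)} {H : Hyp n}
    (h : IsPreimage d G H) : H ⊆ cliqueHyp d G := by
  obtain ⟨h1, rfl⟩ := h
  exact fun e he => mem_cliqueHyp.2 ⟨h1 e he, fun i hi j hj hij => ⟨hij, e, he, hi, hj⟩⟩

theorem isPreimage_cliqueHyp {G : SimpleGraph (Fin n)} (h : ∃ H, IsPreimage d G H) :
    IsPreimage d G (cliqueHyp d G) := by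
  obtain ⟨H, hH⟩ := h
  refine ⟨uniform_cliqueHyp d G, ?_⟩
  ext i j
  constructor
  · rintro ⟨hij, e, he, hi, hj⟩
    exact (mem_cliqueHyp.1 he).2 i hi j hj hij
  · intro h
    rw [← hH.2] at h
    obtain ⟨hij, e, he, hi, hj⟩ := h
    exact ⟨hij, e, hH.subset_cliqueHyp he, hi, hj⟩

theorem proj_eq_iff (hd : 2 ≤ d) {T C : Hyp n} (hC : Uniform d C) (hT : T ⊆ C) :
    proj T = proj C ↔ ∀ c ∈ C, ∀ i ∈ c, ∀ j ∈ c, ∃ e ∈ T, i ∈ e ∧ j ∈ e := by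
  constructor
  · intro h
    have key : ∀ c ∈ C, ∀ i ∈ c, ∀ j ∈ c, i ≠ j → ∃ e ∈ T, i ∈ e ∧ j ∈ e := by
      intro c hc i hi j hj hij
      have h1 : (proj C).Adj i j := ⟨hij, c, hc, hi, hj⟩
      rw [← h] at h1
      exact h1.2
    intro c hc i hi j hj
    by_cases hij : i = j
    · subst hij
      obtain ⟨k, hk, hki⟩ := Finset.exists_mem_ne (by rw [hC c hc]; omega) i
      obtain ⟨e, he, h1, -⟩ := key c hc i hi k hk hki.symm
      exact ⟨e, he, h1, h1⟩
    · exact key c hc i hi j hj hij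
  · intro h
    ext i j
    constructor
    · rintro ⟨hij, e, he, hi⟩
      exact ⟨hij, e, hT he, hi⟩
    · rintro ⟨hij, c, hc, hi, hj⟩
      exact ⟨hij, h c hc i hi j hj⟩

/-- The minimum preimage found by brute force. -/
noncomputable def minPre (d : ℕ) (G : SimpleGraph (Fin n)) : Hyp n :=
  ((best ((hypList d (cliqueHyp d G)).map edgeList)).map (toEdge n)).toFinset

theorem exists_minPre (d : ℕ) (G : SimpleGraph (Fin n)) :
    ∃ T : List (Finset (Fin n)), best ((hypList d (cliqueHyp d G)).map edgeList) = T.map edgeList ∧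
      minPre d G = T.toFinset ∧ T.Sublist (hypList d (cliqueHyp d G)) ∧
      (∀ c ∈ cliqueHyp d G, ∀ i ∈ c, ∀ j ∈ c, ∃ e ∈ T, i ∈ e ∧ j ∈ e) ∧
      ∀ T' : List (Finset (Fin n)), T'.Sublist (hypList d (cliqueHyp d G)) →
        (∀ c ∈ cliqueHyp d G, ∀ i ∈ c, ∀ j ∈ c, ∃ e ∈ T', i ∈ e ∧ j ∈ e) →
        T.length ≤ T'.length := by
  obtain ⟨T, h1, h2, h3, h4⟩ := exists_best (hypList d (cliqueHyp d G))
  simp only [mem_hypList (uniform_cliqueHyp d G)] at h3 h4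
  refine ⟨T, h1, ?_, h2, h3, h4⟩
  rw [minPre, h1, List.map_map]
  congr 1
  exact (List.map_congr_left fun h _ => toEdge_edgeList h).trans (List.map_id _)

/-- Every preimage consists of `d`-cliques, so searching the sublists of the clique list misses
none. -/
theorem isMinPreimage_minPre (hd : 2 ≤ d) {G : SimpleGraph (Fin n)}
    (hG : ∃ H, IsPreimage d G H) : IsMinPreimage d G (minPre d G) := by
  obtain ⟨T, -, h1, h2, h3, h4⟩ := exists_minPre d G
  have hK := isPreimage_cliqueHyp hG
  have hT : T.toFinset ⊆ cliqueHyp d G := fun e he =>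
    (mem_hypList hK.1).1 (h2.subset (List.mem_toFinset.1 he))
  rw [h1]
  refine ⟨⟨fun e he => hK.1 e (hT he), ?_⟩, fun H hH => ?_⟩
  · rw [← hK.2, proj_eq_iff hd hK.1 hT]
    simpa using h3
  · rw [← length_hypList hH.1]
    refine (List.toFinset_card_le T).trans (h4 _ (hypList_sublist hH.subset_cliqueHyp) ?_)
    simp only [mem_hypList hH.1]
    exact (proj_eq_iff hd hK.1 hH.subset_cliqueHyp).1 (hH.2.trans hK.2.symm)

theorem Uniform.component {H : Hyp n} (hH : Uniform d H) (h : Finset (Fin n)) :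
    Uniform d (component H h) := fun e he => hH e (component_subset H h he)

/-- A `d`-clique of the projection of a component is a clique of `G` that shares a pair with some
member, hence is itself a member. So `minPre` applied to this projection searches exactly the
component. -/
theorem cliqueHyp_proj_component (hd : 2 ≤ d) (G : SimpleGraph (Fin n)) (h : Finset (Fin n)) :
    cliqueHyp d (proj (component (cliqueHyp d G) h)) = component (cliqueHyp d G) h := by
  refine Finset.Subset.antisymm (fun e he => ?_)
    (IsPreimage.subset_cliqueHyp ⟨(uniform_cliqueHyp d G).component h, rfl⟩)
  rw [mem_cliqueHyp] at he
  have he' : e ∈ cliqueHyp d G := by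
    refine mem_cliqueHyp.2 ⟨he.1, fun i hi j hj hij => ?_⟩
    obtain ⟨-, c, hc, hic, hjc⟩ := he.2 i hi j hj hij
    exact (mem_cliqueHyp.1 (component_subset _ _ hc)).2 i hic j hjc hij
  obtain ⟨i, hi, j, hj, hij⟩ := Finset.one_lt_card.1 (show 1 < e.card by omega)
  obtain ⟨-, c, hc, hic, hjc⟩ := he.2 i hi j hj hij
  rw [mem_component] at hc ⊢
  exact hc.trans (.of_inter hc.2.1 he' (two_le_card_inter hij hic hjc hi hj))

theorem component_eq_of_mem {H : Hyp n} {h c : Finset (Fin n)} (hc : c ∈ component H h) :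
    component H c = component H h := by
  rw [mem_component] at hc
  ext e
  rw [mem_component, mem_component]
  exact ⟨hc.trans, hc.symm.trans⟩

/-- The union of the brute-force solutions on the 2-connected components of the clique
hypergraph. -/
noncomputable def astar (d : ℕ) (G : SimpleGraph (Fin n)) : Hyp n :=
  open scoped Classical in
  (cliqueHyp d G).filter fun h => h ∈ minPre d (proj (component (cliqueHyp d G) h))

theorem mem_astar {G : SimpleGraph (Fin n)} {h : Finset (Fin n)} :
    h ∈ astar d G ↔ h ∈ cliqueHyp d G ∧ h ∈ minPre d (proj (component (cliqueHyp d G) h)) := by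
  simp [astar]

theorem isMinPreimage_minPre_proj (hd : 2 ≤ d) {C : Hyp n} (hC : Uniform d C) :
    IsMinPreimage d (proj C) (minPre d (proj C)) :=
  isMinPreimage_minPre hd ⟨C, hC, rfl⟩

theorem minPre_component_subset (hd : 2 ≤ d) (G : SimpleGraph (Fin n)) (h : Finset (Fin n)) :
    minPre d (proj (component (cliqueHyp d G) h)) ⊆ component (cliqueHyp d G) h := by
  have h1 := (isMinPreimage_minPre_proj hd
    ((uniform_cliqueHyp d G).component h)).1.subset_cliqueHyp
  rwa [cliqueHyp_proj_component hd] at h1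

theorem mem_astar_iff (hd : 2 ≤ d) {G : SimpleGraph (Fin n)} {h : Finset (Fin n)} :
    h ∈ astar d G ↔ ∃ C, IsTwoComponent (cliqueHyp d G) C ∧ h ∈ minPre d (proj C) := by
  rw [mem_astar]
  constructor
  · rintro ⟨h1, h2⟩
    exact ⟨_, isTwoComponent_iff.2 ⟨h, h1, rfl⟩, h2⟩
  · rintro ⟨C, hC, h2⟩
    obtain ⟨c, hc, rfl⟩ := isTwoComponent_iff.1 hC
    have h3 := minPre_component_subset hd G c h2
    exact ⟨component_subset _ _ h3, by rwa [component_eq_of_mem h3]⟩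

/-- A hyperedge of `H` covering a pair of a clique shares two vertices with that clique, so it
belongs to the same component. -/
theorem isPreimage_inter_component {G : SimpleGraph (Fin n)} {H : Hyp n}
    (hH : IsPreimage d G H) (c : Finset (Fin n)) :
    IsPreimage d (proj (component (cliqueHyp d G) c)) (H ∩ component (cliqueHyp d G) c) := by
  refine ⟨fun e he => hH.1 e (Finset.mem_inter.1 he).1, ?_⟩
  ext i j
  constructor
  · rintro ⟨hij, e, he, hi, hj⟩
    exact ⟨hij, e, (Finset.mem_inter.1 he).2, hi, hj⟩
  · rintro ⟨hij, f, hf, hi, hj⟩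
    have h1 : G.Adj i j := (mem_cliqueHyp.1 (component_subset _ _ hf)).2 i hi j hj hij
    rw [← hH.2] at h1
    obtain ⟨-, e, he, hi', hj'⟩ := h1
    refine ⟨hij, e, Finset.mem_inter.2 ⟨he, ?_⟩, hi', hj'⟩
    rw [mem_component] at hf ⊢
    exact hf.trans (.of_inter hf.2.1 (hH.subset_cliqueHyp he)
      (two_le_card_inter hij hi hj hi' hj'))

theorem isMinPreimage_astar (hd : 2 ≤ d) {G : SimpleGraph (Fin n)}
    (hG : ∃ H, IsPreimage d G H) : IsMinPreimage d G (astar d G) := by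
  classical
  have hK := isPreimage_cliqueHyp hG
  have hsub : astar d G ⊆ cliqueHyp d G := fun e he => (mem_astar.1 he).1
  have hinter : ∀ c, astar d G ∩ component (cliqueHyp d G) c =
      minPre d (proj (component (cliqueHyp d G) c)) := by
    intro c
    ext e
    rw [Finset.mem_inter, mem_astar]
    constructor
    · rintro ⟨⟨-, h1⟩, h2⟩
      rwa [component_eq_of_mem h2] at h1
    · intro h1
      have h2 := minPre_component_subset hd G c h1
      exact ⟨⟨component_subset _ _ h2, by rwa [component_eq_of_mem h2]⟩, h2⟩
  refine ⟨⟨fun e he => hK.1 e (hsub he), ?_⟩, fun H hH => ?_⟩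
  · refine Eq.trans ?_ hK.2
    rw [proj_eq_iff hd hK.1 hsub]
    intro c hc i hi j hj
    have h1 := isMinPreimage_minPre_proj hd ((uniform_cliqueHyp d G).component c)
    obtain ⟨e, he, h2⟩ := (proj_eq_iff hd ((uniform_cliqueHyp d G).component c)
      (minPre_component_subset hd G c)).1 h1.1.2 c (mem_component.2 (.refl hc)) i hi j hj
    rw [← hinter] at he
    exact ⟨e, (Finset.mem_inter.1 he).1, h2⟩
  -- The components partition the clique hypergraph, so minimality can be checked on each one
  -- separately.
  · have key : ∀ F : Hyp n, F ⊆ cliqueHyp d G → F.card =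
        ∑ C ∈ (cliqueHyp d G).image (component (cliqueHyp d G)), (F ∩ C).card := by
      intro F hF
      rw [Finset.card_eq_sum_card_fiberwise (f := component (cliqueHyp d G))
        (fun e he => Finset.mem_image_of_mem _ (hF he))]
      refine Finset.sum_congr rfl fun C hC => ?_
      obtain ⟨c, -, rfl⟩ := Finset.mem_image.1 hC
      congr 1
      ext e
      rw [Finset.mem_filter, Finset.mem_inter]
      refine and_congr_right fun he => ⟨fun h => ?_, component_eq_of_mem⟩
      rw [← h]
      exact mem_component.2 (.refl (hF he))
    rw [key _ hsub, key _ hH.subset_cliqueHyp]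
    refine Finset.sum_le_sum fun C hC => ?_
    obtain ⟨c, -, rfl⟩ := Finset.mem_image.1 hC
    rw [hinter]
    exact (isMinPreimage_minPre_proj hd ((uniform_cliqueHyp d G).component c)).2 _
      (isPreimage_inter_component hH c)

/-! ### Correctness of the algorithm -/

theorem keep_edgeList (hd : 2 ≤ d) (G : SimpleGraph (Fin n)) {h : Finset (Fin n)}
    (hh : h ∈ cliqueHyp d G) :
    keep ((hypList d (cliqueHyp d G)).map edgeList) (edgeList h) = true ↔ h ∈ astar d G := by
  rw [keep, compList_edgeList hd (uniform_cliqueHyp d G) hh, ← cliqueHyp_proj_component hd G h]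
  obtain ⟨T, h1, h2, -⟩ := exists_minPre d (proj (component (cliqueHyp d G) h))
  rw [h1, mem_astar, h2, List.mem_toFinset, List.any_eq_true]
  simp only [List.mem_map, exists_exists_and_eq_and, sameElems_edgeList, hh, true_and,
    exists_eq_right']

theorem encodesHyp_reconstruct (hd : 2 ≤ d) (G : SimpleGraph (Fin n)) :
    EncodesHyp (enc (reconstruct d (adjMatrix G))) (astar d G) := by
  refine ⟨(hypList d (cliqueHyp d G)).filter
    (keep ((hypList d (cliqueHyp d G)).map edgeList) ∘ edgeList),
    (nodup_hypList _ _).filter _, fun h => ?_, ?_⟩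
  · rw [List.mem_filter, mem_hypList (uniform_cliqueHyp d G), Function.comp]
    constructor
    · rintro ⟨h1, h2⟩
      exact (keep_edgeList hd G h1).1 h2
    · intro h1
      have h2 := (mem_astar.1 h1).1
      exact ⟨h2, (keep_edgeList hd G h2).2 h1⟩
  · rw [reconstruct, cliqueList_adjMatrix, List.filter_map]
    change Data.ofList ((List.map edgeList _).map enc) = _
    rw [List.map_map]
    congr 1
    exact List.map_congr_left fun h _ => enc_edgeList h

/-- A program for the algorithm, whose running time is polynomial in the size of the input and
the number of sublists of the 2-connected components. -/
theorem exists_program (hd : 2 ≤ d) : ∃ (M : Prog) (q : Polynomial ℕ),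
    ∀ (n : ℕ) (G : SimpleGraph (Fin n)), OutputsWithin M G (astar d G)
      (q.eval (esize (adjMatrix G) + searchCost (cliqueList d (adjMatrix G)))) := by
  obtain ⟨M, q, h⟩ := CompIn.reconstruct d
  refine ⟨M, q, fun n G => ?_⟩
  obtain ⟨t, h1, h2⟩ := h (adjMatrix G)
  rw [enc_adjMatrix] at h1
  exact ⟨_, t, h1, encodesHyp_reconstruct hd G, h2⟩

theorem esize_adjMatrix_le (G : SimpleGraph (Fin n)) :
    esize (adjMatrix G) ≤ n * (n * 4 + 2) + 1 := by
  refine (esize_list_le (z := n * 4 + 1) fun r hr => ?_).trans (by rw [length_adjMatrix])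
  obtain ⟨i, rfl⟩ := (List.mem_ofFn' _ _).1 hr
  refine (esize_list_le fun b _ => esize_bool b).trans (by rw [List.length_ofFn])

/-- If every 2-connected component of the clique hypergraph has at most `k` hyperedges, then the
brute-force searches inspect polynomially many sublists. -/
theorem searchCost_le (hd : 2 ≤ d) (G : SimpleGraph (Fin n)) {k : ℕ}
    (hk : ∀ h ∈ cliqueHyp d G, (component (cliqueHyp d G) h).card ≤ k) :
    searchCost (cliqueList d (adjMatrix G)) ≤ n ^ d * 2 ^ k := by
  rw [searchCost, cliqueList_adjMatrix]
  refine (List.sum_le_card_nsmul _ (2 ^ k) fun x hx => ?_).trans ?_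
  · simp only [List.map_map, List.mem_map, Function.comp] at hx
    obtain ⟨h, hh, rfl⟩ := hx
    rw [mem_hypList (uniform_cliqueHyp d G)] at hh
    rw [compList_edgeList hd (uniform_cliqueHyp d G) hh, List.length_map,
      length_hypList ((uniform_cliqueHyp d G).component h)]
    exact Nat.pow_le_pow_right (by simp) (hk h hh)
  · rw [smul_eq_mul, List.length_map, List.length_map, length_hypList (uniform_cliqueHyp d G)]
    refine Nat.mul_le_mul_right _ ((Finset.card_le_card fun h hh => ?_).trans
      ((Finset.card_powersetCard d (Finset.univ : Finset (Fin n))).le.trans ?_))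
    · exact Finset.mem_powersetCard.2 ⟨Finset.subset_univ _, uniform_cliqueHyp d G h hh⟩
    · rw [Finset.card_univ, Fintype.card_fin]
      exact Nat.choose_le_pow n d

end Preimages

/-! ### Maximum a posteriori -/

section MAP

variable {n d : ℕ}

theorem prob_eq_sum (d n : ℕ) (p : ℝ) (E : Hyp n → Prop) [DecidablePred E] :
    prob d n p E = ∑ H ∈ (Finset.powersetCard d (Finset.univ : Finset (Fin n))).powerset,
      if E H then p ^ H.card * (1 - p) ^ (n.choose d - H.card) else 0 := by
  rw [prob, Finset.sum_filter]
  exact Finset.sum_congr rfl fun H _ => by congr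

theorem prob_nonneg {p : ℝ} (h0 : 0 ≤ p) (h1 : p ≤ 1) (E : Hyp n → Prop) : 0 ≤ prob d n p E :=
  Finset.sum_nonneg fun _ _ => mul_nonneg (pow_nonneg h0 _) (pow_nonneg (sub_nonneg.2 h1) _)

theorem mem_powerset_powersetCard {H : Hyp n} :
    H ∈ (Finset.powersetCard d (Finset.univ : Finset (Fin n))).powerset ↔ Uniform d H := by
  simp only [Finset.mem_powerset, Finset.subset_iff, Finset.mem_powersetCard, Finset.mem_univ,
    implies_true, true_and, Uniform]

theorem Uniform.card_le {H : Hyp n} (hH : Uniform d H) : H.card ≤ n.choose d := by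
  have := Finset.card_le_card (Finset.mem_powerset.1 (mem_powerset_powersetCard.2 hH))
  rwa [Finset.card_powersetCard, Finset.card_univ, Fintype.card_fin] at this

theorem prob_eq_of_isPreimage {p : ℝ} {G : SimpleGraph (Fin n)} {H : Hyp n}
    (hH : IsPreimage d G H) : prob d n p (fun K => K = H ∧ proj K = G) =
      p ^ H.card * (1 - p) ^ (n.choose d - H.card) := by
  classical
  rw [prob_eq_sum, Finset.sum_eq_single_of_mem H (mem_powerset_powersetCard.2 hH.1)
    fun K _ hne => if_neg fun h => hne h.1, if_pos ⟨rfl, hH.2⟩]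

theorem prob_eq_zero_of_not_isPreimage {p : ℝ} {G : SimpleGraph (Fin n)} {H : Hyp n}
    (hH : ¬ IsPreimage d G H) : prob d n p (fun K => K = H ∧ proj K = G) = 0 := by
  classical
  rw [prob_eq_sum]
  refine Finset.sum_eq_zero fun K hK => if_neg ?_
  rintro ⟨rfl, h⟩
  exact hH ⟨mem_powerset_powersetCard.1 hK, h⟩

theorem posterior_le {p : ℝ} (h0 : 0 ≤ p) (h1 : p ≤ 1) {G : SimpleGraph (Fin n)} {A : Hyp n}
    (hA : IsMinPreimage d G A) (h : p ≤ 1 / 2 ∨ ∀ H, IsPreimage d G H → H = A) (H : Hyp n) :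
    posterior d n p G H ≤ posterior d n p G A := by
  -- Both posteriors have the same denominator; if it vanishes, both quotients are `0`.
  refine div_le_div_of_nonneg_right ?_ (prob_nonneg h0 h1 _)
  by_cases hH : IsPreimage d G H
  · rcases h with h | h
    · rw [prob_eq_of_isPreimage hH, prob_eq_of_isPreimage hA.1]
      have h2 := hA.2 H hH
      have h3 := hH.1.card_le
      obtain ⟨k, hk⟩ := Nat.exists_eq_add_of_le h2
      -- The `k` extra hyperedges of `H` contribute `p ^ k` where `A` has `(1 - p) ^ k`.
      have h4 : n.choose d - A.card = n.choose d - H.card + k := by omega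
      rw [h4, hk, pow_add, pow_add, mul_assoc, mul_comm (p ^ k)]
      gcongr
      linarith
    · rw [h H hH]
  · rw [prob_eq_zero_of_not_isPreimage hH]
    exact prob_nonneg h0 h1 _

/-- For `d = 2` the bound `p ≤ 1 / 2` can fail at small `n`, but then the hyperedges are the edges
of `G` and there is no choice. -/
theorem IsPreimage.eq_cliqueHyp_two {G : SimpleGraph (Fin n)} {H : Hyp n}
    (hH : IsPreimage 2 G H) : H = cliqueHyp 2 G := by
  refine hH.subset_cliqueHyp.antisymm fun h hh => ?_
  obtain ⟨h1, h2⟩ := mem_cliqueHyp.1 hh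
  obtain ⟨i, hi, j, hj, hij⟩ := Finset.one_lt_card.1 (show 1 < h.card by omega)
  have h3 := h2 i hi j hj hij
  rw [← hH.2] at h3
  obtain ⟨-, e, he, hi', hj'⟩ := h3
  have h4 := two_le_card_inter hij hi hj hi' hj'
  have h5 : h ∩ e = h := Finset.eq_of_subset_of_card_le Finset.inter_subset_left (by omega)
  have h6 : h ∩ e = e :=
    Finset.eq_of_subset_of_card_le Finset.inter_subset_right (by rw [hH.1 e he]; omega)
  rwa [← h5, h6]

theorem Uniform.eq_empty (hn : n < d) {H : Hyp n} (hH : Uniform d H) : H = ∅ := by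
  refine Finset.eq_empty_of_forall_notMem fun h hh => ?_
  have h1 := Finset.card_le_univ h
  rw [hH h hh, Fintype.card_fin] at h1
  omega

theorem threshold_lt_one (d : ℕ) : ((d : ℝ) - 1) / (d + 1) < 1 := by
  rw [div_lt_one (by positivity)]; linarith

theorem edgeProb_nonneg (d n : ℕ) (δ : ℝ) : 0 ≤ edgeProb d n δ :=
  Real.rpow_nonneg (Nat.cast_nonneg n) _

theorem edgeProb_le_one (hd : 2 ≤ d) {δ : ℝ} (hδ : δ < ((d : ℝ) - 1) / (d + 1)) :
    edgeProb d n δ ≤ 1 := by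
  have h1 := threshold_lt_one d
  have h2 : (2 : ℝ) ≤ d := by exact_mod_cast hd
  have h3 : -(d : ℝ) + 1 + δ < 0 := by linarith
  rcases Nat.eq_zero_or_pos n with rfl | hn
  · rw [edgeProb, Nat.cast_zero, Real.zero_rpow h3.ne]; exact zero_le_one
  · exact Real.rpow_le_one_of_one_le_of_nonpos (by exact_mod_cast hn) h3.le

theorem edgeProb_le_half (hd : 3 ≤ d) (hn : 2 ≤ n) {δ : ℝ}
    (hδ : δ < ((d : ℝ) - 1) / (d + 1)) : edgeProb d n δ ≤ 1 / 2 := by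
  have h1 := threshold_lt_one d
  have h2 : (3 : ℝ) ≤ d := by exact_mod_cast hd
  have h3 : (2 : ℝ) ≤ n := by exact_mod_cast hn
  -- From `d ≥ 3` and `δ < 1`, the exponent is at most `-1`.
  calc edgeProb d n δ ≤ (n : ℝ) ^ (-1 : ℝ) :=
        Real.rpow_le_rpow_of_exponent_le (by linarith) (by linarith)
    _ = 1 / n := by rw [Real.rpow_neg_one, one_div]
    _ ≤ 1 / 2 := one_div_le_one_div_of_le (by norm_num) h3

theorem posterior_le_of_isMinPreimage (hd : 2 ≤ d) {δ : ℝ} (hδ : δ < ((d : ℝ) - 1) / (d + 1))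
    {G : SimpleGraph (Fin n)} {A : Hyp n} (hA : IsMinPreimage d G A) (H : Hyp n) :
    posterior d n (edgeProb d n δ) G H ≤ posterior d n (edgeProb d n δ) G A := by
  refine posterior_le (edgeProb_nonneg d n δ) (edgeProb_le_one hd hδ) hA ?_ H
  rcases lt_or_ge n d with hn | hn
  · exact .inr fun K hK => (hK.1.eq_empty hn).trans (hA.1.1.eq_empty hn).symm
  · rcases hd.eq_or_lt with rfl | hd
    · exact .inr fun K hK => hK.eq_cliqueHyp_two.trans hA.1.eq_cliqueHyp_two.symm
    · exact .inl (edgeProb_le_half hd (by omega) hδ)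

end MAP

/-! ### Growth of the components -/

section Growth

variable {n d : ℕ}

/-- The set of vertices covered by a hypergraph. -/
def support (S : Hyp n) : Finset (Fin n) := S.biUnion id

theorem mem_support {S : Hyp n} {i : Fin n} : i ∈ support S ↔ ∃ e ∈ S, i ∈ e := by
  simp [support]

theorem Uniform.card_support_le {S : Hyp n} (hS : Uniform d S) :
    (support S).card ≤ S.card * d :=
  Finset.card_biUnion_le_card_mul _ _ _ fun e he => (hS e he).le

/-- Covering a clique that shares two vertices with the support of `S`, but is not inside it. -/
theorem exists_extension {H S : Hyp n} (hH : Uniform d H)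
    {h : Finset (Fin n)} (hh : h ∈ cliqueHyp d (proj H)) (h2 : 2 ≤ (h ∩ support S).card)
    (hsub : ¬ h ⊆ support S) :
    ∃ T : Hyp n, T ⊆ H ∧ Disjoint S T ∧ 1 ≤ T.card ∧ T.card ≤ d ^ 2 ∧
      (d + 1) * (support (S ∪ T)).card ≤
        (d + 1) * (support S).card + T.card * (d * (d - 1)) := by
  set V := support S with hV
  obtain ⟨hc, hadj⟩ := mem_cliqueHyp.1 hh
  -- `P` consists of the ordered pairs of `h` not inside `V`. A hyperedge covering one of them has a
  -- vertex outside `V`, so it is new.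
  let P := h.offDiag \ (h ∩ V).offDiag
  have hP : ∀ p ∈ P, p.1 ∈ h ∧ p.2 ∈ h ∧ p.1 ≠ p.2 ∧ (p.1 ∉ V ∨ p.2 ∉ V) := by
    intro p hp
    simp only [P, Finset.mem_sdiff, Finset.mem_offDiag, Finset.mem_inter] at hp
    tauto
  have hex : ∀ p ∈ P, ∃ e ∈ H, p.1 ∈ e ∧ p.2 ∈ e := fun p hp =>
    (hadj _ (hP p hp).1 _ (hP p hp).2.1 (hP p hp).2.2.1).2
  choose! f hf using hex
  let T := P.image f
  have hT : ∀ e ∈ T, e ∈ H ∧ 2 ≤ (h ∩ e).card ∧ e ∉ S := by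
    intro e he
    obtain ⟨p, hp, rfl⟩ := Finset.mem_image.1 he
    obtain ⟨h3, h4, h5, h6⟩ := hP p hp
    obtain ⟨h7, h8, h9⟩ := hf p hp
    refine ⟨h7, two_le_card_inter h5 h3 h4 h8 h9, fun h10 => ?_⟩
    rcases h6 with h6 | h6
    · exact h6 (mem_support.2 ⟨_, h10, h8⟩)
    · exact h6 (mem_support.2 ⟨_, h10, h9⟩)
  have hPT : P.card ≤ ∑ e ∈ T, (h ∩ e).offDiag.card := by
    refine (Finset.card_le_card fun p hp => ?_).trans Finset.card_biUnion_le
    obtain ⟨h3, h4, h5, -⟩ := hP p hp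
    obtain ⟨-, h8, h9⟩ := hf p hp
    exact Finset.mem_biUnion.2 ⟨f p, Finset.mem_image_of_mem f hp, Finset.mem_offDiag.2
      ⟨Finset.mem_inter.2 ⟨h3, h8⟩, Finset.mem_inter.2 ⟨h4, h9⟩, h5⟩⟩
  have hPcard : h.card * h.card - h.card ≤
      P.card + ((h ∩ V).card * (h ∩ V).card - (h ∩ V).card) := by
    have h3 := Finset.card_le_card_sdiff_add_card (s := h.offDiag) (t := (h ∩ V).offDiag)
    rwa [Finset.offDiag_card, Finset.offDiag_card] at h3
  have hsupp : (support (S ∪ T)).card ≤ V.card + (h \ V).card + ∑ e ∈ T, (e \ h).card := by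
    refine (Finset.card_le_card (t := (V ∪ (h \ V)) ∪ T.biUnion fun e => e \ h)
      fun i hi => ?_).trans ((Finset.card_union_le _ _).trans
        (add_le_add (Finset.card_union_le _ _) Finset.card_biUnion_le))
    obtain ⟨e, he, hi⟩ := mem_support.1 hi
    simp only [Finset.mem_union, Finset.mem_sdiff, Finset.mem_biUnion]
    rcases Finset.mem_union.1 he with he | he
    · exact .inl (.inl (mem_support.2 ⟨e, he, hi⟩))
    · by_cases h3 : i ∈ V
      · exact .inl (.inl h3)
      · by_cases h4 : i ∈ h
        · exact .inl (.inr ⟨h4, h3⟩)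
        · exact .inr ⟨e, he, hi, h4⟩
  refine ⟨T, fun e he => (hT e he).1, Finset.disjoint_right.2 fun e he => (hT e he).2.2, ?_, ?_, ?_⟩
  · obtain ⟨u, hu, huV⟩ := Finset.not_subset.1 hsub
    obtain ⟨v, hv⟩ := Finset.card_pos.1 (show 0 < (h ∩ V).card by omega)
    rw [Finset.mem_inter] at hv
    refine Finset.card_pos.2 ⟨_, Finset.mem_image_of_mem f (a := (u, v)) ?_⟩
    simp only [P, Finset.mem_sdiff, Finset.mem_offDiag, Finset.mem_inter]
    refine ⟨⟨hu, hv.1, ?_⟩, fun h3 => huV h3.1.2⟩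
    rintro rfl
    exact huV hv.2
  · refine Finset.card_image_le.trans ((Finset.card_le_card Finset.sdiff_subset).trans ?_)
    rw [Finset.offDiag_card, hc, sq]
    exact Nat.sub_le _ _
  · have hs : (h ∩ V).card + (h \ V).card = d := by
      rw [← hc, Finset.card_inter_add_card_sdiff]
    -- With `t = |h ∩ e| ≥ 2`: `d(d-1) - t(t-1) = (d-t)(d+t-1) ≥ (d-t)(d+1)`.
    have hpair : ∀ e ∈ T, ((h ∩ e).offDiag.card : ℤ) + (d + 1) * (e \ h).card ≤ d * (d - 1) := by
      intro e he
      have h3 := (hT e he).2.1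
      have h4 : (h ∩ e).card + (e \ h).card = d := by
        rw [← hH e (hT e he).1, Finset.inter_comm, Finset.card_inter_add_card_sdiff]
      rw [Finset.offDiag_card, Nat.cast_sub (Nat.le_mul_self _)]
      zify at h3 h4
      push_cast
      have h5 : (0 : ℤ) ≤ (e \ h).card := Nat.cast_nonneg _
      nlinarith
    have hsum := Finset.sum_le_sum hpair
    rw [Finset.sum_add_distrib, ← Finset.mul_sum, Finset.sum_const, nsmul_eq_mul] at hsum
    have h1 : 1 ≤ d := by omega
    zify [h1, Nat.le_mul_self (h ∩ V).card, Nat.le_mul_self h.card] at *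
    rw [hc] at hPcard
    have h5 : (0 : ℤ) ≤ (h \ V).card := Nat.cast_nonneg _
    -- The same factorisation with `|h ∩ V| ≥ 2` in place of `t`. Thus `P` pays for the new vertices
    -- in `h`, and `hsum` pays for `P` and for the new vertices outside `h`.
    have h6 : (d + 1 : ℤ) * (h \ V).card ≤ P.card := by nlinarith
    nlinarith

/-- A component with a member sharing two vertices with `V` is inside `V`, or has a member
sharing two vertices with `V` that is not inside `V`. -/
theorem exists_boundary {K : Hyp n} {c : Finset (Fin n)} {V : Finset (Fin n)}
    {h : Finset (Fin n)} (hh : h ∈ component K c) (h2 : 2 ≤ (h ∩ V).card) :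
    (∀ e ∈ component K c, e ⊆ V) ∨ ∃ e ∈ component K c, 2 ≤ (e ∩ V).card ∧ ¬ e ⊆ V := by
  by_contra! hcon
  obtain ⟨⟨e, he, heV⟩, hcon⟩ := hcon
  -- A neighbour of a member inside `V` shares two vertices with `V`, so without a boundary member
  -- containment in `V` propagates along walks.
  have key : ∀ (x y : {e // e ∈ K}), (twoNeighborGraph K).Walk x y → x.1 ∈ component K c →
      x.1 ⊆ V → y.1 ⊆ V := by
    intro x y p
    induction p with
    | nil => exact fun _ h => h
    | @cons x z y hadj p ih =>
      intro h3 h4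
      have h5 : z.1 ∈ component K c :=
        mem_component.2 ((mem_component.1 h3).trans (.of_inter x.2 z.2 hadj.2))
      refine ih h5 (hcon _ h5 (hadj.2.trans (Finset.card_le_card ?_)))
      rw [Finset.inter_comm]
      exact Finset.inter_subset_inter_left h4
  obtain ⟨h3, h4, hr⟩ := (mem_component.1 hh).symm.trans (mem_component.1 he)
  obtain ⟨p⟩ := hr
  exact heV (key _ _ p hh (hcon h hh h2))

/-- Exploration for `r` rounds. The left side of the last inequality is the first-moment exponent;
it equals `d - (d - 1 - δ) = 1 + δ` for one hyperedge. The member meeting the support in two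
vertices lets `exists_boundary` continue the exploration. -/
theorem exists_growth (hd : 2 ≤ d) {H : Hyp n} (hH : Uniform d H) {c : Finset (Fin n)}
    (hc : c ∈ cliqueHyp d (proj H)) {δ : ℝ} (hδ : δ < ((d : ℝ) - 1) / (d + 1)) (r : ℕ) :
    ∃ S ⊆ H, S.card ≤ 1 + r * d ^ 2 ∧
      (∃ h ∈ component (cliqueHyp d (proj H)) c, 2 ≤ (h ∩ support S).card) ∧
      ((∀ h ∈ component (cliqueHyp d (proj H)) c, h ⊆ support S) ∨
        ((support S).card : ℝ) - S.card * (d - 1 - δ) ≤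
          1 + δ - r * (((d : ℝ) - 1) / (d + 1) - δ)) := by
  induction r with
  | zero =>
    obtain ⟨h1, h2⟩ := mem_cliqueHyp.1 hc
    obtain ⟨i, hi, j, hj, hij⟩ := Finset.one_lt_card.1 (show 1 < c.card by omega)
    obtain ⟨-, e, he, hi', hj'⟩ := h2 i hi j hj hij
    refine ⟨{e}, by simpa using he, by simp, ⟨c, mem_component.2 (.refl hc), ?_⟩, .inr ?_⟩
    · exact two_le_card_inter hij hi hj (mem_support.2 ⟨e, by simp, hi'⟩)
        (mem_support.2 ⟨e, by simp, hj'⟩)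
    · simp only [support, Finset.singleton_biUnion, id, hH e he, Finset.card_singleton]
      push_cast
      linarith
  | succ r ih =>
    obtain ⟨S, hS, hcard, ⟨h, hh, h2⟩, h3⟩ := ih
    rcases exists_boundary hh h2 with h4 | ⟨e, he, h5, h6⟩
    · exact ⟨S, hS, hcard.trans (by gcongr; omega), ⟨h, hh, h2⟩, .inl h4⟩
    · have h3 := h3.resolve_left fun h => h6 (h e he)
      obtain ⟨T, hT, hdisj, hT1, hTd, hsupp⟩ :=
        exists_extension hH (component_subset _ _ he) h5 h6
      refine ⟨S ∪ T, Finset.union_subset hS hT, ?_, ⟨h, hh, h2.trans (Finset.card_le_card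
        (Finset.inter_subset_inter_left (Finset.biUnion_subset_biUnion_of_subset_left _
          Finset.subset_union_left)))⟩, .inr ?_⟩
      · rw [Finset.card_union_of_disjoint hdisj, add_mul]; omega
      · have hd1 : (0 : ℝ) < d + 1 := by positivity
        have h7 : (((d : ℝ) + 1) * (support (S ∪ T)).card) ≤
            (d + 1) * (support S).card + T.card * (d * (d - 1)) := by
          have := (Nat.cast_le (α := ℝ)).2 hsupp
          push_cast [Nat.cast_sub (show 1 ≤ d by omega)] at this
          exact this
        have h8 : ((support (S ∪ T)).card : ℝ) ≤
            (support S).card + T.card * (d * (d - 1) / (d + 1)) := by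
          rw [← mul_le_mul_iff_right₀ hd1]
          refine h7.trans (le_of_eq ?_)
          field_simp
        have h9 : (1 : ℝ) ≤ T.card := by exact_mod_cast hT1
        -- Each added hyperedge lowers the exponent by at least `(d-1)/(d+1) - δ > 0`, and `T` is
        -- nonempty.
        have h10 : (d : ℝ) * (d - 1) / (d + 1) = d - 1 - (d - 1) / (d + 1) := by
          field_simp; ring
        rw [h10] at h8
        rw [Finset.card_union_of_disjoint hdisj]
        push_cast
        generalize ((d : ℝ) - 1) / (d + 1) = θ at *
        nlinarith

/-- If all the small subhypergraphs are sparse, then the 2-connected components of the clique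
hypergraph have bounded size. -/
theorem card_component_le (hd : 2 ≤ d) {δ : ℝ} (hδ : δ < ((d : ℝ) - 1) / (d + 1)) :
    ∃ k : ℕ, ∀ (n : ℕ) (H : Hyp n), Uniform d H →
      (∀ S ⊆ H, S.card ≤ k → (S.card : ℝ) * (d - 1 - δ) ≤ (support S).card) →
      ∀ c ∈ cliqueHyp d (proj H), (component (cliqueHyp d (proj H)) c).card ≤ 2 ^ (k * d) := by
  -- So many rounds would make the exponent negative, against sparsity.
  obtain ⟨r, hr⟩ := exists_nat_gt ((1 + δ) / (((d : ℝ) - 1) / (d + 1) - δ))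
  rw [div_lt_iff₀ (sub_pos.2 hδ)] at hr
  refine ⟨1 + r * d ^ 2, fun n H hH hsparse c hc => ?_⟩
  obtain ⟨S, hS, hcard, -, h⟩ := exists_growth hd hH hc hδ r
  have h1 := hsparse S hS hcard
  have h2 := h.resolve_right (by linarith)
  refine (Finset.card_le_card fun e he => Finset.mem_powerset.2 (h2 e he)).trans ?_
  rw [Finset.card_powerset]
  refine Nat.pow_le_pow_right (by simp) ?_
  have h3 : Uniform d S := fun e he => hH e (hS he)
  exact h3.card_support_le.trans (Nat.mul_le_mul_right _ hcard)

end Growth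

/-! ### First moment -/

section FirstMoment

variable {n d : ℕ}

/-- Writing `H = S ∪ T` with `T` disjoint from `S`, the weights of the `T` sum to `1` by the
binomial theorem. -/
theorem prob_superset {p : ℝ} {S : Hyp n} (hS : Uniform d S) :
    prob d n p (fun H => S ⊆ H) = p ^ S.card := by
  set E := Finset.powersetCard d (Finset.univ : Finset (Fin n)) with hE
  have hSE : S ⊆ E := Finset.mem_powerset.1 (mem_powerset_powersetCard.2 hS)
  have hcard : n.choose d = (E \ S).card + S.card := by
    rw [Finset.card_sdiff_add_card_eq_card hSE, Finset.card_powersetCard, Finset.card_univ,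
      Fintype.card_fin]
  have h1 := Finset.sum_pow_mul_eq_add_pow p (1 - p) (E \ S)
  rw [add_sub_cancel, one_pow] at h1
  have h2 : p ^ S.card = ∑ T ∈ (E \ S).powerset,
      p ^ S.card * (p ^ T.card * (1 - p) ^ ((E \ S).card - T.card)) := by
    rw [← Finset.mul_sum, h1, mul_one]
  rw [prob_eq_sum, ← Finset.sum_filter, h2]
  refine (Finset.sum_bij' (fun T _ => S ∪ T) (fun H _ => H \ S) ?_ ?_ ?_ ?_ ?_).symm
  · intro T hT
    rw [Finset.mem_powerset] at hT
    rw [Finset.mem_filter, Finset.mem_powerset]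
    exact ⟨Finset.union_subset hSE (hT.trans Finset.sdiff_subset), Finset.subset_union_left⟩
  · intro H hH
    rw [Finset.mem_filter, Finset.mem_powerset] at hH
    exact Finset.mem_powerset.2 (Finset.sdiff_subset_sdiff hH.1 (Finset.Subset.refl _))
  · intro T hT
    rw [Finset.mem_powerset] at hT
    exact Finset.union_sdiff_cancel_left (Finset.disjoint_of_subset_right hT Finset.disjoint_sdiff)
  · intro H hH
    rw [Finset.mem_filter, Finset.mem_powerset] at hH
    exact Finset.union_sdiff_of_subset hH.2
  · intro T hT
    rw [Finset.mem_powerset] at hT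
    rw [Finset.card_union_of_disjoint (Finset.disjoint_of_subset_right hT Finset.disjoint_sdiff),
      pow_add, mul_assoc,
      show n.choose d - (S.card + T.card) = (E \ S).card - T.card by omega]

theorem prob_true (d n : ℕ) (p : ℝ) : prob d n p (fun _ => True) = 1 := by
  have := prob_superset (p := p) (S := (∅ : Hyp n)) (d := d) (by simp [Uniform])
  simpa using this

theorem prob_le_one {p : ℝ} (h0 : 0 ≤ p) (h1 : p ≤ 1) (E : Hyp n → Prop) :
    prob d n p E ≤ 1 := by
  classical
  rw [← prob_true d n p, prob_eq_sum, prob_eq_sum]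
  refine Finset.sum_le_sum fun H _ => ?_
  have : 0 ≤ p ^ H.card * (1 - p) ^ (n.choose d - H.card) :=
    mul_nonneg (pow_nonneg h0 _) (pow_nonneg (sub_nonneg.2 h1) _)
  split <;> simp [this]

/-- The union bound over the subhypergraphs in `F`. -/
theorem one_sub_sum_le_prob {p : ℝ} (h0 : 0 ≤ p) (h1 : p ≤ 1) (E : Hyp n → Prop)
    (F : Finset (Hyp n)) (hF : ∀ S ∈ F, Uniform d S)
    (hE : ∀ H : Hyp n, Uniform d H → (∀ S ∈ F, ¬ S ⊆ H) → E H) :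
    1 - ∑ S ∈ F, p ^ S.card ≤ prob d n p E := by
  classical
  rw [sub_le_iff_le_add, ← prob_true d n p]
  rw [← Finset.sum_congr rfl fun S hS => prob_superset (p := p) (hF S hS)]
  simp only [prob_eq_sum]
  rw [Finset.sum_comm, ← Finset.sum_add_distrib]
  refine Finset.sum_le_sum fun H hH => ?_
  have hw : 0 ≤ p ^ H.card * (1 - p) ^ (n.choose d - H.card) :=
    mul_nonneg (pow_nonneg h0 _) (pow_nonneg (sub_nonneg.2 h1) _)
  have hs : ∀ S ∈ F, 0 ≤ if S ⊆ H then p ^ H.card * (1 - p) ^ (n.choose d - H.card) else 0 :=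
    fun S _ => by split <;> simp [hw]
  rw [if_pos trivial]
  by_cases h : E H
  · rw [if_pos h]
    exact le_add_of_nonneg_right (Finset.sum_nonneg hs)
  · have h2 : ∃ S ∈ F, S ⊆ H := by
      by_contra! h3
      exact h (hE H (mem_powerset_powersetCard.1 hH) h3)
    obtain ⟨S, hS, hSH⟩ := h2
    rw [if_neg h, zero_add]
    refine le_trans ?_ (Finset.single_le_sum hs hS)
    rw [if_pos hSH]

/-- The uniform hypergraphs with at most `k` hyperedges and too few vertices. -/
noncomputable def denseHyps (d k : ℕ) (δ : ℝ) (n : ℕ) : Finset (Hyp n) :=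
  open scoped Classical in
  (Finset.powersetCard d (Finset.univ : Finset (Fin n))).powerset.filter fun S =>
    S.card ≤ k ∧ ((support S).card : ℝ) < S.card * (d - 1 - δ)

theorem mem_denseHyps {k : ℕ} {δ : ℝ} {S : Hyp n} : S ∈ denseHyps d k δ n ↔
    Uniform d S ∧ S.card ≤ k ∧ ((support S).card : ℝ) < S.card * (d - 1 - δ) := by
  rw [denseHyps, Finset.mem_filter, mem_powerset_powersetCard]

/-- Finitely many pairs `(v, s)` occur, so the strict inequalities have a common margin `η`, which
becomes the decay `n ^ (-η)`. -/
theorem exists_gap (d k : ℕ) (δ : ℝ) : ∃ η : ℝ, 0 < η ∧ ∀ v ∈ Finset.range (k * d + 1),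
    ∀ s ∈ Finset.range (k + 1), (v : ℝ) < s * (d - 1 - δ) → (v : ℝ) + η ≤ s * (d - 1 - δ) := by
  have h : ∀ᶠ η : ℝ in 𝓝[>] 0, ∀ v ∈ Finset.range (k * d + 1),
      ∀ s ∈ Finset.range (k + 1), (v : ℝ) < s * (d - 1 - δ) → (v : ℝ) + η ≤ s * (d - 1 - δ) := by
    rw [Filter.eventually_all_finset]
    intro v _
    rw [Filter.eventually_all_finset]
    intro s _
    by_cases hvs : (v : ℝ) < s * (d - 1 - δ)
    · filter_upwards [Ioo_mem_nhdsGT (sub_pos.2 hvs)] with η hη _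
      linarith [hη.2]
    · exact .of_forall fun η h => absurd h hvs
  obtain ⟨η, h1, h2⟩ := (h.and self_mem_nhdsWithin).exists
  exact ⟨η, h2, h1⟩

/-- Group by the support `U`: at most `2 ^ 2 ^ v` hypergraphs live on `U`, and the at most `n ^ j`
sets `U` of size `j` weigh `n ^ (-j)` each. -/
theorem sum_inv_support_le (hn : 1 ≤ n) {v : ℕ} {F : Finset (Hyp n)}
    (hF : ∀ S ∈ F, (support S).card ≤ v) :
    ∑ S ∈ F, ((n : ℝ) ^ (support S).card)⁻¹ ≤ (v + 1) * 2 ^ 2 ^ v := by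
  have hn' : (0 : ℝ) < n := by exact_mod_cast hn
  let W : Finset (Finset (Fin n)) := Finset.univ.filter fun U => U.card ≤ v
  calc ∑ S ∈ F, ((n : ℝ) ^ (support S).card)⁻¹
      = ∑ U ∈ W, ∑ S ∈ F with support S = U, ((n : ℝ) ^ (support S).card)⁻¹ :=
        (Finset.sum_fiberwise_of_maps_to (fun S hS => by simp [W, hF S hS]) _).symm
    _ ≤ ∑ U ∈ W, 2 ^ 2 ^ v * ((n : ℝ) ^ U.card)⁻¹ := by
        refine Finset.sum_le_sum fun U hU => ?_
        rw [Finset.sum_congr rfl fun S hS => by rw [(Finset.mem_filter.1 hS).2], Finset.sum_const,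
          nsmul_eq_mul]
        refine mul_le_mul_of_nonneg_right ?_ (by positivity)
        have h1 : (F.filter fun S => support S = U) ⊆ U.powerset.powerset := by
          intro S hS
          rw [Finset.mem_powerset]
          intro e he
          rw [Finset.mem_powerset, ← (Finset.mem_filter.1 hS).2]
          exact fun i hi => mem_support.2 ⟨e, he, hi⟩
        have h2 := Finset.card_le_card h1
        rw [Finset.card_powerset, Finset.card_powerset] at h2
        have h3 : U.card ≤ v := (Finset.mem_filter.1 hU).2
        exact_mod_cast h2.trans (Nat.pow_le_pow_right (by simp) (Nat.pow_le_pow_right (by simp) h3))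
    _ = 2 ^ 2 ^ v * ∑ j ∈ Finset.range (v + 1),
          ∑ U ∈ W with U.card = j, ((n : ℝ) ^ U.card)⁻¹ := by
        rw [← Finset.mul_sum]
        congr 1
        refine (Finset.sum_fiberwise_of_maps_to (fun U hU => ?_) _).symm
        have := (Finset.mem_filter.1 hU).2
        exact Finset.mem_range.2 (by omega)
    _ ≤ 2 ^ 2 ^ v * ∑ j ∈ Finset.range (v + 1), 1 := by
        refine mul_le_mul_of_nonneg_left (Finset.sum_le_sum fun j _ => ?_) (by positivity)
        rw [Finset.sum_congr rfl fun U hU => by rw [(Finset.mem_filter.1 hU).2], Finset.sum_const,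
          nsmul_eq_mul, ← div_eq_mul_inv, div_le_one (by positivity)]
        have h1 : (W.filter fun U => U.card = j) ⊆ Finset.powersetCard j Finset.univ := fun U hU =>
          Finset.mem_powersetCard.2 ⟨Finset.subset_univ _, (Finset.mem_filter.1 hU).2⟩
        have h2 := Finset.card_le_card h1
        rw [Finset.card_powersetCard, Finset.card_univ, Fintype.card_fin] at h2
        exact_mod_cast h2.trans (Nat.choose_le_pow n j)
    _ = (v + 1) * 2 ^ 2 ^ v := by simp [mul_comm]

theorem tendsto_sum_denseHyps (d k : ℕ) (δ : ℝ) :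
    Tendsto (fun n => ∑ S ∈ denseHyps d k δ n, edgeProb d n δ ^ S.card) atTop (𝓝 0) := by
  obtain ⟨η, hη, hgap⟩ := exists_gap d k δ
  have h1 : Tendsto (fun n : ℕ => (((k * d : ℕ) : ℝ) + 1) * 2 ^ 2 ^ (k * d) * (n : ℝ) ^ (-η))
      atTop (𝓝 0) := by
    simpa only [mul_zero, Function.comp_def] using ((tendsto_rpow_neg_atTop hη).comp
      tendsto_natCast_atTop_atTop).const_mul ((((k * d : ℕ) : ℝ) + 1) * 2 ^ 2 ^ (k * d))
  refine squeeze_zero' (.of_forall fun n => Finset.sum_nonneg fun S _ =>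
    pow_nonneg (edgeProb_nonneg d n δ) _) ?_ h1
  filter_upwards [eventually_ge_atTop 1] with n hn
  have hn' : (1 : ℝ) ≤ n := by exact_mod_cast hn
  have hsupp : ∀ S ∈ denseHyps d k δ n, (support S).card ≤ k * d := fun S hS => by
    obtain ⟨h2, h3, -⟩ := mem_denseHyps.1 hS
    exact h2.card_support_le.trans (Nat.mul_le_mul_right _ h3)
  refine le_trans ?_ (mul_le_mul_of_nonneg_right (sum_inv_support_le hn hsupp) (by positivity))
  rw [Finset.sum_mul]
  refine Finset.sum_le_sum fun S hS => ?_
  obtain ⟨-, h3, h4⟩ := mem_denseHyps.1 hS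
  have h5 := hgap _ (Finset.mem_range.2 (Nat.lt_succ_of_le (hsupp S hS))) _
    (Finset.mem_range.2 (Nat.lt_succ_of_le h3)) h4
  -- By the margin, `p ^ |S| = n ^ (-|S| (d - 1 - δ))` is at most `n ^ (-|support S|) * n ^ (-η)`.
  rw [edgeProb, ← Real.rpow_natCast, ← Real.rpow_natCast, ← Real.rpow_mul (by linarith),
    ← Real.rpow_neg (by linarith), ← Real.rpow_add (by linarith)]
  exact Real.rpow_le_rpow_of_exponent_le hn' (by nlinarith)

end FirstMoment

/-! ### Polynomial time with high probability, and the main theorem. -/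

theorem OutputsWithin.mono {n : ℕ} {M : Prog} {G : SimpleGraph (Fin n)} {H : Hyp n} {T T' : ℕ}
    (h : OutputsWithin M G H T) (hT : T ≤ T') : OutputsWithin M G H T' :=
  let ⟨y, t, h1, h2, h3⟩ := h; ⟨y, t, h1, h2, h3.trans hT⟩

/-- The algorithm runs in polynomial time with high probability. -/
theorem tendsto_prob_outputsWithin {d : ℕ} (hd : 2 ≤ d) {M : Prog} {q : Polynomial ℕ}
    (hM : ∀ (n : ℕ) (G : SimpleGraph (Fin n)), OutputsWithin M G (astar d G)
      (q.eval (esize (adjMatrix G) + searchCost (cliqueList d (adjMatrix G)))))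
    {δ : ℝ} (hδ : δ < ((d : ℝ) - 1) / (d + 1)) :
    ∃ q' : Polynomial ℕ, Tendsto (fun n : ℕ => prob d n (edgeProb d n δ) (fun H =>
      OutputsWithin M (proj H) (astar d (proj H)) (q'.eval n))) atTop (𝓝 1) := by
  obtain ⟨k, hk⟩ := card_component_le hd hδ
  -- The size of the adjacency matrix plus, for each of at most `n ^ d` cliques, the sublists of a
  -- component with at most `2 ^ (k * d)` hyperedges.
  refine ⟨q.comp (.X * (.X * 4 + 2) + 1 + .X ^ d * .C (2 ^ 2 ^ (k * d))), ?_⟩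
  have h1 := (tendsto_sum_denseHyps d k δ).const_sub 1
  rw [sub_zero] at h1
  refine tendsto_of_tendsto_of_tendsto_of_le_of_le h1 tendsto_const_nhds (fun n => ?_)
    fun n => prob_le_one (edgeProb_nonneg d n δ) (edgeProb_le_one hd hδ) _
  refine one_sub_sum_le_prob (edgeProb_nonneg d n δ) (edgeProb_le_one hd hδ) _ _
    (fun S hS => (mem_denseHyps.1 hS).1) fun H hH hsparse => (hM n (proj H)).mono ?_
  rw [Polynomial.eval_comp]
  refine eval_le_eval q ?_
  simp only [Polynomial.eval_add, Polynomial.eval_mul, Polynomial.eval_X, Polynomial.eval_ofNat,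
    Polynomial.eval_one, Polynomial.eval_pow, Polynomial.eval_C]
  refine add_le_add (esize_adjMatrix_le _) (searchCost_le hd _ (hk n H hH fun S hS hSk => ?_))
  by_contra! hcon
  exact hsparse S (mem_denseHyps.2 ⟨fun e he => hH e (hS he), hSk, hcon⟩) hS

end HypRec

theorem mainTheorem3 (d : ℕ) (hd : 2 ≤ d) :
    ∃ (Astar : ∀ n : ℕ, SimpleGraph (Fin n) → HypRec.Hyp n)
      (B : ∀ n : ℕ, HypRec.Hyp n → HypRec.Hyp n) (M : HypRec.Prog),
      -- `Astar` outputs a minimum preimage of every projected graph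
      (∀ (n : ℕ) (G : SimpleGraph (Fin n)), (∃ H, HypRec.IsPreimage d G H) →
        HypRec.IsMinPreimage d G (Astar n G)) ∧
      -- which is the union, over the 2-connected components `C` of the clique hypergraph, of
      -- minimum preimages `B n C` of the projections of `C`
      (∀ (n : ℕ) (C : HypRec.Hyp n), HypRec.Uniform d C →
        HypRec.IsMinPreimage d (HypRec.proj C) (B n C)) ∧
      (∀ (n : ℕ) (G : SimpleGraph (Fin n)), (∃ H, HypRec.IsPreimage d G H) →
        ∀ h : Finset (Fin n), h ∈ Astar n G ↔
          ∃ C, HypRec.IsTwoComponent (HypRec.cliqueHyp d G) C ∧ h ∈ B n C) ∧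
      -- the program `M` always computes `Astar`
      (∀ (n : ℕ) (G : SimpleGraph (Fin n)), (∃ H, HypRec.IsPreimage d G H) →
        ∃ T : ℕ, HypRec.OutputsWithin M G (Astar n G) T) ∧
      ∀ δ : ℝ, δ < ((d : ℝ) - 1) / ((d : ℝ) + 1) →
        -- `Astar` maximizes the posterior probability
        (∀ (n : ℕ) (G : SimpleGraph (Fin n)), (∃ H, HypRec.IsPreimage d G H) →
          ∀ H : HypRec.Hyp n,
            HypRec.posterior d n (HypRec.edgeProb d n δ) G H ≤
              HypRec.posterior d n (HypRec.edgeProb d n δ) G (Astar n G)) ∧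
        -- with high probability `M` runs in polynomial time
        ∃ q : Polynomial ℕ,
          Tendsto (fun n : ℕ => HypRec.prob d n (HypRec.edgeProb d n δ) (fun H =>
              HypRec.OutputsWithin M (HypRec.proj H) (Astar n (HypRec.proj H)) (q.eval n)))
            atTop (𝓝 1) := by
  obtain ⟨M, q, hM⟩ := HypRec.exists_program hd
  exact ⟨fun _ G => HypRec.astar d G, fun _ C => HypRec.minPre d (HypRec.proj C), M,
    fun _ _ hG => HypRec.isMinPreimage_astar hd hG,
    fun _ _ hC => HypRec.isMinPreimage_minPre_proj hd hC,
    fun _ _ _ _ => HypRec.mem_astar_iff hd,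
    fun n G _ => ⟨_, hM n G⟩,
    fun _ hδ => ⟨fun _ _ hG H =>
      HypRec.posterior_le_of_isMinPreimage hd hδ (HypRec.isMinPreimage_astar hd hG) H,
      HypRec.tendsto_prob_outputsWithin hd hM hδ⟩⟩
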